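/- Let $K$ be a field and let $K_0(\mathcal V_K)$ be the Grothendieck ring of varieties over $K$: generated by isomorphism classes $[X]$ of varieties, with $[X]=[Z]+[X\smallsetminus Z]$ for $Z\subset X$ closed and $[X]\cdot[Y]=[X\times Y]$. Put $\mathbb T=[\mathbb A^1]-1\in K_0(\mathcal V_K)$. For a finite graph $G$ (multiple edges and loops allowed) with edge set $E$, let $$\Psi_G=\sum_{T}\ \prod_{e\notin T}t_e ,$$ where $T$ ranges over the spanning trees of $G$, and let $\mathbb U(G)=[\mathbb A^{E}\smallsetminus\{\Psi_G=0\}]\in K_0(\mathcal V_K)$ be the class of the complement of the affine graph hypersurface of $G$. For $s,n\ge 1$ let $\Sigma^s_n$ be the valence-4 vacuum melonic star with $s$ rays of $n$ nodes. Thus $\Sigma^s_n$ is the union of a central oval and of ovals $O_{i,j}$ ($i\in\mathbb Z/s$, $1\le j\le n$), where $O_{i,j}$ meets its predecessor ($O_{i,j-1}$, or the central oval if $j=1$) in two vertices $L_{i,j},R_{i,j}$, and there are no other intersections; the edges are the arcs of the ovals between these vertices. Explicitly, $\Sigma^s_n$ has the $2sn$ vertices $L_{i,j},R_{i,j}$ and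 the following $4sn$ edges: two edges $L_{i,j}R_{i,j}$ for all $i,j$; edges $L_{i,j}L_{i,j+1}$ and $R_{i,j}R_{i,j+1}$ for all $i$ and $1\le j<n$; one further edge $L_{i,n}R_{i,n}$ for all $i$; and one edge $R_{i,1}L_{i+1,1}$ for all $i\in\mathbb Z/s$. Define $a_k(r,t)\in\mathbb Z[r,t]$ by $$e^{rx}\cos\big((r^2-rt)^{1/2}x\big)=\sum_{k\ge0}a_k(r,t)\frac{x^k}{k!},$$ polynomials $A_n(t)\in\mathbb Z[t]$ by $\sum_{k\ge 0}a_k(r,t)=\sum_{n\ge0}A_n(t)r^n$, and polynomials $\sigma^s_n(t)\in\mathbb Z[t]$ by $$\frac{1-2r+((s-1)t-(s-2))r^2}{1-(2+t)r+2r^2}=1+\sum_{n\ge0}\sigma^s_n(t)\,r^{n+1}.$$ Then for all $s,n\ge1$ $$\mathbb U(\Sigma^s_n)=\mathbb T^{sn}(\mathbb T+1)^{2sn-1}A_n(\mathbb T)^{s-1}\sigma^s_n(\mathbb T).$$ -/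

import Mathlib

open CategoryTheory CategoryTheory.Limits AlgebraicGeometry

universe u

noncomputable section

/-! ## The Grothendieck ring of varieties -/

/-- A variety over the field `K`: a separated scheme of finite type over `K`. (Nilpotents are
allowed; they are invisible in the Grothendieck ring, where the scissor relation with empty
complement gives `[X] = [X_red]`.) -/
structure KVariety (K : Type u) [Field K] : Type (u + 1) where
  toScheme : Scheme.{u}
  str : toScheme ⟶ Spec (CommRingCat.of K)
  [locallyOfFiniteType : LocallyOfFiniteType str]
  [quasiCompact : QuasiCompact str]
  [isSeparated : IsSeparated str]

attribute [instance] KVariety.locallyOfFiniteType KVariety.quasiCompact KVariety.isSeparated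

namespace KVariety

variable {K : Type u} [Field K]

/-- The one-point variety `Spec K`. -/
def point (K : Type u) [Field K] : KVariety K where
  toScheme := Spec (CommRingCat.of K)
  str := 𝟙 _

/-- The product of two varieties, i.e. their fibre product over `Spec K`. -/
def prod (X Y : KVariety K) : KVariety K where
  toScheme := pullback X.str Y.str
  str := pullback.fst X.str Y.str ≫ X.str

/-- The affine space over `K` with coordinates indexed by the finite type `E`. -/
def affineSpace (K : Type u) [Field K] (E : Type) [Finite E] : KVariety K where
  toScheme := Spec (CommRingCat.of (MvPolynomial E K))
  str := Spec.map (CommRingCat.ofHom (algebraMap K (MvPolynomial E K)))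
  locallyOfFiniteType := by
    rw [HasRingHomProperty.Spec_iff (P := @LocallyOfFiniteType)]
    exact RingHom.finiteType_algebraMap.2 inferInstance

/-- The open set of points of affine space at which `f` does not vanish. -/
def nonvanishingLocus {E : Type} [Finite E] (f : MvPolynomial E K) :
    (affineSpace K E).toScheme.Opens :=
  PrimeSpectrum.basicOpen f

/-- The complement, in the affine space with coordinates indexed by `E`, of the affine
hypersurface `f = 0`, as an open subscheme. -/
def hypersurfaceComplement {E : Type} [Finite E] (f : MvPolynomial E K) : KVariety K where
  toScheme := (nonvanishingLocus f).toScheme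
  str := (nonvanishingLocus f).ι ≫ (affineSpace K E).str
  quasiCompact := by
    have : IsNoetherian (affineSpace K E).toScheme :=
      inferInstanceAs (IsNoetherian (Spec (CommRingCat.of (MvPolynomial E K))))
    infer_instance

end KVariety

/-- The defining relations of the Grothendieck ring of varieties over `K`: isomorphic varieties
have the same class; `[X] = [Z] + [X ∖ Z]` for `Z` closed in `X`; `[X × Y] = [X] [Y]`;
`[Spec K] = 1`. -/
inductive GrothendieckRel (K : Type u) [Field K] :
    FreeCommRing (KVariety K) → FreeCommRing (KVariety K) → Prop
  | iso (X Y : KVariety K) (e : X.toScheme ≅ Y.toScheme) (he : e.hom ≫ Y.str = X.str) :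
      GrothendieckRel K (FreeCommRing.of X) (FreeCommRing.of Y)
  | scissor (X Z U : KVariety K) (i : Z.toScheme ⟶ X.toScheme) (j : U.toScheme ⟶ X.toScheme)
      (hi : i ≫ X.str = Z.str) (hj : j ≫ X.str = U.str)
      (hiclosed : IsClosedImmersion i) (hjopen : IsOpenImmersion j)
      (hcompl : IsCompl (Set.range i) (Set.range j)) :
      GrothendieckRel K (FreeCommRing.of X) (FreeCommRing.of Z + FreeCommRing.of U)
  | mul (X Y : KVariety K) :
      GrothendieckRel K (FreeCommRing.of (X.prod Y)) (FreeCommRing.of X * FreeCommRing.of Y)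
  | one : GrothendieckRel K (FreeCommRing.of (KVariety.point K)) 1

/-- The Grothendieck ring `K₀(𝒱_K)` of varieties over `K`. It is presented as a commutative ring;
as the product of varieties respects isomorphisms and the scissor relation, its additive group is
the abelian group generated by isomorphism classes of varieties modulo the scissor relation. -/
def GrothendieckRing (K : Type u) [Field K] : Type (u + 1) := RingQuot (GrothendieckRel K)

instance (K : Type u) [Field K] : CommRing (GrothendieckRing K) :=
  inferInstanceAs (CommRing (RingQuot (GrothendieckRel K)))

/-- The class `[X]` of a variety in the Grothendieck ring. -/
def KVariety.cls {K : Type u} [Field K] (X : KVariety K) : GrothendieckRing K :=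
  RingQuot.mkRingHom (GrothendieckRel K) (FreeCommRing.of X)

/-- The Lefschetz motive `𝕃 = [𝔸¹]`. -/
def lefschetz (K : Type u) [Field K] : GrothendieckRing K := (KVariety.affineSpace K Unit).cls

/-- The class of the torus, `𝕋 = 𝕃 - 1`. -/
def torusClass (K : Type u) [Field K] : GrothendieckRing K := lefschetz K - 1

/-! ## Graphs, Kirchhoff–Symanzik polynomials, Grothendieck classes -/

/-- A graph with vertex set `V` and edge set `E`, in which multiple edges and looping edges are
allowed: every edge has an unordered pair of end vertices. -/
structure Multigraph (V E : Type) where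
  ends : E → Sym2 V

namespace Multigraph

variable {V E : Type}

/-- A set `T` of edges is (the edge set of) a spanning tree: it has no looping edge and no two
parallel edges, and the simple graph that it forms on the whole vertex set is a tree. -/
def IsSpanningTree (G : Multigraph V E) (T : Finset E) : Prop :=
  (∀ e ∈ T, ¬ (G.ends e).IsDiag) ∧ Set.InjOn G.ends T ∧
    (SimpleGraph.fromEdgeSet (G.ends '' (T : Set E))).IsTree

open Classical in
/-- The Kirchhoff–Symanzik polynomial `Ψ_G = ∑_T ∏_{e ∉ T} t_e`, the sum ranging over the
spanning trees `T` of `G`. -/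
def kirchhoffSymanzik [Fintype E] (K : Type u) [Field K] (G : Multigraph V E) :
    MvPolynomial E K :=
  ∑ T : Finset E with G.IsSpanningTree T, ∏ e ∈ Tᶜ, MvPolynomial.X e

/-- The Grothendieck class `𝕌(G)` of a graph: the class of the complement of the affine graph
hypersurface `Ψ_G = 0` in the affine space whose coordinates are indexed by the edges. -/
def grothendieckClass [Fintype E] (K : Type u) [Field K] (G : Multigraph V E) :
    GrothendieckRing K :=
  (KVariety.hypersurfaceComplement (G.kirchhoffSymanzik K)).cls

end Multigraph

/-! ## The melonic stars -/

/-- The vacuum melonic star `Σ^s_n` with `s` rays of `n` nodes, all of whose vertices have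
valence four.

It is a union of closed curves (ovals): a central one, and ovals `(i, j)` for `i < s`, `j < n`.
The oval `(i, j)` meets its predecessor (the oval `(i, j - 1)`, or the central one if `j = 0`) in
two points, which are the vertices `(i, j, false)` and `(i, j, true)`, and the edges of the graph
are the arcs into which these vertices cut the ovals. For every `(i, j)` there are four edges:

* `(i, j, 0)`: the arc joining `(i, j, false)` and `(i, j, true)` on the predecessor of the oval
  `(i, j)`;
* `(i, j, 1)`: the arc of the oval `(i, j)` itself joining `(i, j, false)` and `(i, j, true)` on
  the side not met by further ovals;
* `(i, j, 2)`: on the other side of the oval `(i, j)`, the arc from `(i, j, false)` to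
  `(i, j + 1, false)`, or, for the last oval of the ray, the arc from `(i, j, false)` to
  `(i, j, true)`;
* `(i, j, 3)`: the arc ending at `(i, j, true)` on the predecessor of the oval `(i, j)`: it comes
  from `(i, j - 1, true)` if `j ≠ 0`, and if `j = 0` it is the arc of the central oval that leads
  on to the vertex `(i + 1, 0, false)` of the next ray in cyclic order.

In other words, `(i, j, false)` and `(i, j, true)` are joined by a `3`-banana, and the string of a
single edge, the `3`-banana of `(i, j + 1)`, and a single edge replaces one edge of it; the
central oval is a closed string that consists alternately of single edges and the `3`-bananas of
`(i, 0)`, for `i < s`. -/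
def starGraph (s n : ℕ) : Multigraph (Fin s × Fin n × Bool) (Fin s × Fin n × Fin 4) where
  ends := fun (i, j, c) => match c with
    | 0 => s((i, j, false), (i, j, true))
    | 1 => s((i, j, false), (i, j, true))
    | 2 => if h : j.val + 1 < n then s((i, j, false), (i, ⟨j.val + 1, h⟩, false))
        else s((i, j, false), (i, j, true))
    | 3 => if j.val = 0 then s((i, j, true), (finRotate s i, j, false))
        else s((i, ⟨j.val - 1, by omega⟩, true), (i, j, true))

/-! ## The polynomials `A_n` -/

/-- The polynomials `a_k(r, t) ∈ ℤ[t][r]` with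
`e^{r x} cos((r² - r t)^{1/2} x) = ∑_k a_k(r, t) x^k / k!`; see `expCosPoly_expansion`.
Here `r` is the outer and `t` the inner variable. -/
def expCosPoly (k : ℕ) : Polynomial (Polynomial ℤ) :=
  ∑ l ∈ Finset.range (k / 2 + 1), ((-1) ^ l * (k.choose (2 * l) : Polynomial (Polynomial ℤ))) *
    Polynomial.X ^ (k - 2 * l) *
      (Polynomial.X ^ 2 - Polynomial.X * Polynomial.C Polynomial.X) ^ l

/-- The polynomial `A_n(t)`, i.e. the coefficient of `r ^ n` in the formal power series
`∑_k a_k(r, t)`. Only `k ≤ 2 n` contribute; see `coeff_expCosPoly_of_lt`. -/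
def polyA (n : ℕ) : Polynomial ℤ :=
  ∑ k ∈ Finset.range (2 * n + 1), (expCosPoly k).coeff n

theorem expCosPoly_expansion {B : Type*} [CommRing B] [Algebra ℚ B] (r t τ : B)
    (hτ : τ ^ 2 = r ^ 2 - r * t) :
    PowerSeries.rescale r (PowerSeries.exp B) * PowerSeries.rescale τ (PowerSeries.cos B) =
      PowerSeries.mk fun k => algebraMap ℚ B (1 / (k.factorial : ℚ)) *
        (expCosPoly k).eval₂ (Polynomial.aeval t : Polynomial ℤ →ₐ[ℤ] B).toRingHom r := by
  ext1 k
  rw [mul_comm, PowerSeries.coeff_mul, Finset.Nat.sum_antidiagonal_eq_sum_range_succ_mk,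
    PowerSeries.coeff_mk, expCosPoly, Polynomial.eval₂_finsetSum, Finset.mul_sum]
  have hinj : Set.InjOn (fun l : ℕ => 2 * l) (Finset.range (k / 2 + 1) : Set ℕ) := by
    intro a _ b _ h
    simpa using h
  have himg : ((Finset.range (k / 2 + 1)).image fun l => 2 * l) ⊆ Finset.range (k + 1) := by
    intro m hm
    simp only [Finset.mem_image, Finset.mem_range] at hm ⊢
    omega
  rw [← Finset.sum_subset himg, Finset.sum_image hinj]
  · refine Finset.sum_congr rfl fun l hl => ?_
    have hlk : 2 * l ≤ k := by
      simp only [Finset.mem_range] at hl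
      omega
    have hfac : algebraMap ℚ B ((-1) ^ l / ((2 * l).factorial : ℚ)) *
        algebraMap ℚ B (1 / ((k - 2 * l).factorial : ℚ)) =
        algebraMap ℚ B (1 / (k.factorial : ℚ)) * ((-1) ^ l * (k.choose (2 * l) : B)) := by
      rw [← map_natCast (algebraMap ℚ B) (k.choose (2 * l)), Nat.cast_choose ℚ hlk]
      have h1 : (-1 : B) = algebraMap ℚ B (-1) := by simp
      rw [h1, ← map_pow, ← map_mul, ← map_mul, ← map_mul]
      congr 1
      have := Nat.factorial_ne_zero k
      field_simp
    have hd : 2 * l / 2 = l := by omega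
    simp only [PowerSeries.coeff_rescale, PowerSeries.cos, PowerSeries.exp, PowerSeries.coeff_mk,
      even_two_mul, if_true, hd, Polynomial.eval₂_mul, Polynomial.eval₂_pow, Polynomial.eval₂_X,
      Polynomial.eval₂_sub, Polynomial.eval₂_neg, Polynomial.eval₂_one, Polynomial.eval₂_natCast,
      Polynomial.eval₂_C, AlgHom.toRingHom_eq_coe, RingHom.coe_coe, Polynomial.aeval_X]
    rw [pow_mul, hτ]
    linear_combination (r ^ 2 - r * t) ^ l * r ^ (k - 2 * l) * hfac
  · intro m _ hm
    have hodd : ¬ Even m := by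
      rintro ⟨l, rfl⟩
      apply hm
      simp only [Finset.mem_image, Finset.mem_range] at *
      exact ⟨l, by omega, by omega⟩
    simp [PowerSeries.coeff_rescale, PowerSeries.cos, hodd]

theorem coeff_expCosPoly_of_lt {n k : ℕ} (h : 2 * n < k) : (expCosPoly k).coeff n = 0 := by
  rw [expCosPoly, Polynomial.finsetSum_coeff]
  refine Finset.sum_eq_zero fun l hl => ?_
  have hlk : 2 * l ≤ k := by
    simp only [Finset.mem_range] at hl
    omega
  have hX : (Polynomial.X : Polynomial (Polynomial ℤ)) ^ (k - l) ∣
      ((-1) ^ l * (k.choose (2 * l) : Polynomial (Polynomial ℤ))) *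
        Polynomial.X ^ (k - 2 * l) *
          (Polynomial.X ^ 2 - Polynomial.X * Polynomial.C Polynomial.X) ^ l := by
    refine ⟨((-1) ^ l * (k.choose (2 * l) : Polynomial (Polynomial ℤ))) *
      (Polynomial.X - Polynomial.C Polynomial.X) ^ l, ?_⟩
    have h1 : k - l = (k - 2 * l) + l := by omega
    have h2 : (Polynomial.X ^ 2 - Polynomial.X * Polynomial.C Polynomial.X :
        Polynomial (Polynomial ℤ)) = Polynomial.X * (Polynomial.X - Polynomial.C Polynomial.X) := by
      ring
    rw [h1, h2, mul_pow, pow_add]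
    ring
  exact Polynomial.X_pow_dvd_iff.1 hX n (by omega)

/-! ## The polynomials `σ^s_n` -/

/-- The numerator `1 - 2 r + ((s - 1) t - (s - 2)) r²`, as a power series in `r` over `ℤ[t]`. -/
def starNum (s : ℕ) : PowerSeries (Polynomial ℤ) :=
  1 - 2 * PowerSeries.X +
    PowerSeries.C (((s : Polynomial ℤ) - 1) * Polynomial.X - ((s : Polynomial ℤ) - 2)) *
      PowerSeries.X ^ 2

/-- The denominator `1 - (2 + t) r + 2 r²`, as a power series in `r` over `ℤ[t]`. -/
def starDen : PowerSeries (Polynomial ℤ) :=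
  1 - PowerSeries.C (2 + Polynomial.X) * PowerSeries.X + 2 * PowerSeries.X ^ 2

/-- The polynomials `σ^s_n(t)` with `starNum s / starDen = 1 + ∑_{n ≥ 0} σ^s_n(t) r^{n+1}`;
see `polySigma_expansion`. -/
def polySigma (s n : ℕ) : Polynomial ℤ :=
  PowerSeries.coeff (n + 1) (starNum s * PowerSeries.invOfUnit starDen 1)

theorem polySigma_expansion (s : ℕ) :
    starNum s = starDen * (1 + PowerSeries.X * PowerSeries.mk fun n => polySigma s n) := by
  have hc : PowerSeries.constantCoeff starDen = ((1 : (Polynomial ℤ)ˣ) : Polynomial ℤ) := by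
    simp [starDen]
  have h := PowerSeries.mul_invOfUnit starDen 1 hc
  have h2 : starNum s * PowerSeries.invOfUnit starDen 1 =
      1 + PowerSeries.X * PowerSeries.mk fun n => polySigma s n := by
    ext1 m
    cases m with
    | zero => simp [starNum]
    | succ m => simp [polySigma, PowerSeries.coeff_succ_X_mul, PowerSeries.coeff_one]
  rw [← h2, mul_left_comm, h, mul_one]

end

/-! Cut the central oval at the vertex `(0, 0, false)`. The star becomes a chain of rays with two
terminals, and each ray is built recursively by series and parallel operations. For a two-terminal
network let `P` be its spanning tree polynomial and `Q` the one after identification of the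
terminals. A single edge has the pair `(1, t)`; networks in series have `(P₁P₂, Q₁P₂ + P₁Q₂)`, and
networks in parallel have `(Q₁P₂ + P₁Q₂, Q₁Q₂)`. Closing the chain identifies its terminals, so the
polynomial of the star is the `Q` of the chain (`Network.aeval_kirchhoffSymanzik`).

For the classes it suffices to carry `p = [P ≠ 0]` and `m = [P = 0 ≠ Q]` (`PairClass`). Where `P ≠
0`, rescaling by `P` turns the added node into a 3-banana with free variables; where `P = 0`, only
`Q` enters. Hence `p` and `m` change linearly from node to node (`PairClass.node`, `rayClass`). In a
chain of `s` rays the locus `P = 0 ≠ Q` forces exactly one ray to have `P = 0`, which gives `p ^ s`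
and `s m p ^ (s - 1)`. One edge `d` of the central oval is kept for the end: `Q + d P ≠ 0` has class
`𝕋 p + 𝕃 m` (`PairClass.hasClass_series_edge`).

After powers of `𝕋` and `𝕃` are removed, the node recursion has a matrix with trace `2 + t` and
determinant `2`. Both `A_n` and `σ^s_n` obey the resulting recurrence, and `σ^s_n = t A_n + s B_n`,
where `(A_n, B_n)` is the orbit of `(1, 0)` (`polyA_eq`, `polySigma_eq`).

Two devices carry the details. Classes are compared on points over all `K`-algebras, by Yoneda:
strata are given by "unit" and "zero", and isomorphisms by formulas. Spanning trees are treated as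
minimal sets of edges along which only constant 2-colourings of the vertices are constant; the
colourings of the chain are then analysed by induction (`Network.ray_describes`,
`Network.chain_describes`). -/

noncomputable section

/-! ### Classes of affine varieties in the Grothendieck ring -/

namespace KVariety

variable {K : Type u} [Field K]

/-- The spectrum of a finitely generated `K`-algebra, as a variety over `K`. -/
def spec (K : Type u) [Field K] (A : Type u) [CommRing A] [Algebra K A]
    [Algebra.FiniteType K A] : KVariety K where
  toScheme := Spec (CommRingCat.of A)
  str := Spec.map (CommRingCat.ofHom (algebraMap K A))
  locallyOfFiniteType := by
    rw [HasRingHomProperty.Spec_iff (P := @LocallyOfFiniteType)]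
    exact RingHom.finiteType_algebraMap.2 inferInstance

theorem cls_eq_of_iso {X Y : KVariety K} (e : X.toScheme ≅ Y.toScheme)
    (he : e.hom ≫ Y.str = X.str) : X.cls = Y.cls :=
  RingQuot.mkRingHom_rel (GrothendieckRel.iso X Y e he)

section

variable {A B : Type u} [CommRing A] [Algebra K A] [Algebra.FiniteType K A]
  [CommRing B] [Algebra K B] [Algebra.FiniteType K B]

theorem cls_spec_congr (e : A ≃ₐ[K] B) : (spec K A).cls = (spec K B).cls := by
  refine cls_eq_of_iso (Scheme.Spec.mapIso e.symm.toRingEquiv.toCommRingCatIso.op) ?_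
  change Spec.map (CommRingCat.ofHom (e.symm : B →+* A)) ≫ Spec.map _ = Spec.map _
  rw [← Spec.map_comp, ← CommRingCat.ofHom_comp]
  congr 2
  exact e.symm.toAlgHom.comp_algebraMap

theorem cls_spec_self (K : Type u) [Field K] : (spec K K).cls = 1 := by
  have h : (point K).cls = 1 := by
    have := RingQuot.mkRingHom_rel (GrothendieckRel.one (K := K))
    rwa [map_one] at this
  rw [← h]
  refine cls_eq_of_iso (Iso.refl _) ?_
  change 𝟙 _ ≫ 𝟙 _ = Spec.map (CommRingCat.ofHom (RingHom.id K))
  simp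

instance : Algebra.FiniteType K (TensorProduct K A B) :=
  Algebra.FiniteType.trans (S := A) inferInstance inferInstance

theorem cls_spec_tensorProduct :
    (spec K (TensorProduct K A B)).cls = (spec K A).cls * (spec K B).cls := by
  have h : ((spec K A).prod (spec K B)).cls = (spec K A).cls * (spec K B).cls := by
    have := RingQuot.mkRingHom_rel (GrothendieckRel.mul (spec K A) (spec K B))
    rwa [map_mul] at this
  rw [← h]
  exact (cls_eq_of_iso (X := (spec K A).prod (spec K B)) (Y := spec K (TensorProduct K A B))
    (pullbackSpecIso K A B) (pullbackSpecIso_hom_base K A B)).symm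

/-- The scissor relation for the closed subset `V(f)` and its open complement `D(f)`, both of which
are affine. -/
theorem cls_spec_scissor (f : A) :
    (spec K A).cls = (spec K (Localization.Away f)).cls + (spec K (A ⧸ Ideal.span {f})).cls := by
  have h := RingQuot.mkRingHom_rel (GrothendieckRel.scissor (spec K A)
    (spec K (A ⧸ Ideal.span {f})) (spec K (Localization.Away f))
    (Spec.map (CommRingCat.ofHom (algebraMap A (A ⧸ Ideal.span {f}))))
    (Spec.map (CommRingCat.ofHom (algebraMap A (Localization.Away f)))) ?_ ?_ ?_ ?_ ?_)
  · rw [map_add] at h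
    rw [add_comm]
    exact h
  · change Spec.map _ ≫ Spec.map _ = Spec.map _
    rw [← Spec.map_comp, ← CommRingCat.ofHom_comp, ← IsScalarTower.algebraMap_eq]
  · change Spec.map _ ≫ Spec.map _ = Spec.map _
    rw [← Spec.map_comp, ← CommRingCat.ofHom_comp, ← IsScalarTower.algebraMap_eq]
  · exact IsClosedImmersion.spec_of_surjective _ Ideal.Quotient.mk_surjective
  · exact inferInstanceAs (IsOpenImmersion
      (Spec.map (CommRingCat.ofHom (algebraMap A (Localization.Away f)))))
  · have h1 := range_comap_of_surjective _ (algebraMap A (A ⧸ Ideal.span {f}))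
      Ideal.Quotient.mk_surjective
    have h2 := PrimeSpectrum.localization_away_comap_range (Localization.Away f) f
    change IsCompl (Set.range (PrimeSpectrum.comap (algebraMap A (A ⧸ Ideal.span {f}))))
      (Set.range (PrimeSpectrum.comap (algebraMap A (Localization.Away f))))
    rw [h1, h2]
    have h3 : RingHom.ker (algebraMap A (A ⧸ Ideal.span {f})) = Ideal.span {f} :=
      Ideal.mk_ker
    rw [h3, PrimeSpectrum.zeroLocus_span, PrimeSpectrum.basicOpen_eq_zeroLocus_compl]
    exact isCompl_compl

end

theorem cls_hypersurfaceComplement {E : Type} [Finite E] (f : MvPolynomial E K) :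
    (hypersurfaceComplement f).cls = (spec K (Localization.Away f)).cls := by
  refine cls_eq_of_iso (basicOpenIsoSpecAway (R := CommRingCat.of (MvPolynomial E K)) f) ?_
  have h := basicOpenIsoSpecAway_hom_SpecMap (R := CommRingCat.of (MvPolynomial E K)) f
  have h2 : Spec.map (CommRingCat.ofHom (algebraMap K (Localization.Away f))) =
      Spec.map (CommRingCat.ofHom (algebraMap (MvPolynomial E K) (Localization.Away f))) ≫
        Spec.map (CommRingCat.ofHom (algebraMap K (MvPolynomial E K))) := by
    rw [← Spec.map_comp, ← CommRingCat.ofHom_comp, ← IsScalarTower.algebraMap_eq]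
  exact (congrArg (_ ≫ ·) h2).trans ((Category.assoc _ _ _).symm.trans (congrArg (· ≫ _) h))

end KVariety

/-! ## Functors of points and classes of subfunctors -/

/-- A functor from commutative `K`-algebras to types. -/
structure PointFunctor (K : Type u) [Field K] where
  obj : (B : Type u) → [CommRing B] → [Algebra K B] → Type u
  map : {B C : Type u} → [CommRing B] → [Algebra K B] → [CommRing C] → [Algebra K C] →
    (B →ₐ[K] C) → obj B → obj C
  map_id : ∀ {B : Type u} [CommRing B] [Algebra K B] (x : obj B), map (AlgHom.id K B) x = x
  map_comp : ∀ {B C D : Type u} [CommRing B] [Algebra K B] [CommRing C] [Algebra K C]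
    [CommRing D] [Algebra K D] (ψ : C →ₐ[K] D) (φ : B →ₐ[K] C) (x : obj B),
    map (ψ.comp φ) x = map ψ (map φ x)

namespace PointFunctor

variable {K : Type u} [Field K]

/-- The affine line `B ↦ B`. -/
abbrev line (K : Type u) [Field K] : PointFunctor K where
  obj B := B
  map φ x := φ x
  map_id _ := rfl
  map_comp _ _ _ := rfl

/-- The functor with exactly one point over every algebra. -/
abbrev pt (K : Type u) [Field K] : PointFunctor K where
  obj _ := PUnit
  map _ x := x
  map_id _ := rfl
  map_comp _ _ _ := rfl

/-- The product of two functors. -/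
abbrev prod (F G : PointFunctor K) : PointFunctor K where
  obj B := F.obj B × G.obj B
  map φ x := (F.map φ x.1, G.map φ x.2)
  map_id x := by simp [F.map_id, G.map_id]
  map_comp ψ φ x := by simp [F.map_comp, G.map_comp]

/-- The power of a functor with exponent `ι`. -/
abbrev pow (F : PointFunctor K) (ι : Type) : PointFunctor K where
  obj B := ι → F.obj B
  map φ x i := F.map φ (x i)
  map_id x := by simp [F.map_id]
  map_comp ψ φ x := by simp [F.map_comp]

/-- A condition on the points of a functor. -/
abbrev Cond (F : PointFunctor K) : Type (u + 1) :=
  ∀ (B : Type u) [CommRing B] [Algebra K B], F.obj B → Prop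

/-- A family of maps between the point sets of two functors. -/
abbrev Trans (F G : PointFunctor K) : Type (u + 1) :=
  ∀ (B : Type u) [CommRing B] [Algebra K B], F.obj B → G.obj B

/-- A family of functions on the point sets of a functor. -/
abbrev Fun (F : PointFunctor K) : Type (u + 1) :=
  ∀ (B : Type u) [CommRing B] [Algebra K B], F.obj B → B

/-- Naturality of a family of functions. -/
def NatFun {F : PointFunctor K} (f : F.Fun) : Prop :=
  ∀ ⦃B C : Type u⦄ [CommRing B] [Algebra K B] [CommRing C] [Algebra K C] (φ : B →ₐ[K] C)
    (x : F.obj B), f C (F.map φ x) = φ (f B x)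

/-- Naturality of a family of maps. -/
def Natural {F G : PointFunctor K} (f : F.Trans G) : Prop :=
  ∀ ⦃B C : Type u⦄ [CommRing B] [Algebra K B] [CommRing C] [Algebra K C] (φ : B →ₐ[K] C)
    (x : F.obj B), f C (F.map φ x) = G.map φ (f B x)

/-- The points of `F` that satisfy `Φ` are the specializations of the point `x` over `A`. -/
def Represents (F : PointFunctor K) (Φ : F.Cond) (A : Type u) [CommRing A] [Algebra K A]
    (x : F.obj A) : Prop :=
  ∀ (B : Type u) [CommRing B] [Algebra K B],
    (∀ φ : A →ₐ[K] B, Φ B (F.map φ x)) ∧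
      ∀ y : F.obj B, Φ B y → ∃! φ : A →ₐ[K] B, F.map φ x = y

/-- The points of `F` that satisfy `Φ` are represented by an affine variety of class `c`. -/
def HasClass (F : PointFunctor K) (Φ : F.Cond) (c : GrothendieckRing K) : Prop :=
  ∃ (A : Type u) (_ : CommRing A) (_ : Algebra K A) (_ : Algebra.FiniteType K A) (x : F.obj A),
    (KVariety.spec K A).cls = c ∧ F.Represents Φ A x

variable {F G : PointFunctor K}

/-- A natural transformation that is bijective on the points in question preserves classes. -/
theorem HasClass.of_bijOn {Φ : F.Cond} {Ψ : G.Cond} {c : GrothendieckRing K}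
    (h : F.HasClass Φ c) (f : F.Trans G) (hf : Natural f)
    (hmaps : ∀ (B : Type u) [CommRing B] [Algebra K B] (x : F.obj B), Φ B x → Ψ B (f B x))
    (hbij : ∀ (B : Type u) [CommRing B] [Algebra K B] (y : G.obj B), Ψ B y →
      ∃! x : F.obj B, Φ B x ∧ f B x = y) : G.HasClass Ψ c := by
  obtain ⟨A, _, _, _, x, hc, hA⟩ := id h
  refine ⟨A, _, _, ‹_›, f A x, hc, fun B _ _ => ⟨fun φ => ?_, fun y hy => ?_⟩⟩
  · rw [← hf]
    exact hmaps B _ ((hA B).1 φ)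
  · obtain ⟨x', ⟨hx', rfl⟩, huniq⟩ := hbij B y hy
    obtain ⟨φ, rfl, hφ⟩ := (hA B).2 x' hx'
    refine ⟨φ, (hf φ x).symm, fun ψ hψ => hφ ψ (huniq _ ⟨(hA B).1 ψ, ?_⟩)⟩
    rw [hf]
    exact hψ

theorem HasClass.congr {Φ Ψ : F.Cond} {c : GrothendieckRing K} (h : F.HasClass Φ c)
    (hΦ : ∀ (B : Type u) [CommRing B] [Algebra K B] (x : F.obj B), Φ B x ↔ Ψ B x) :
    F.HasClass Ψ c := by
  refine h.of_bijOn (fun B _ _ x => x) (fun B C _ _ _ _ φ x => rfl)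
    (fun B _ _ x hx => (hΦ B x).1 hx) fun B _ _ y hy => ⟨y, ⟨(hΦ B y).2 hy, rfl⟩, ?_⟩
  rintro _ ⟨-, rfl⟩
  rfl

/-- Yoneda: two representing algebras have universal points that specialize to each other, which
gives mutually inverse homomorphisms. -/
theorem HasClass.unique {Φ : F.Cond} {c d : GrothendieckRing K} (h : F.HasClass Φ c)
    (h' : F.HasClass Φ d) : c = d := by
  obtain ⟨A, _, _, _, x, rfl, hA⟩ := h
  obtain ⟨A', _, _, _, x', rfl, hA'⟩ := h'
  have hx : Φ A x := by
    have := (hA A).1 (AlgHom.id K A)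
    rwa [F.map_id] at this
  have hx' : Φ A' x' := by
    have := (hA' A').1 (AlgHom.id K A')
    rwa [F.map_id] at this
  obtain ⟨φ, hφ, -⟩ := (hA A').2 x' hx'
  obtain ⟨ψ, hψ, -⟩ := (hA' A).2 x hx
  refine KVariety.cls_spec_congr (AlgEquiv.ofAlgHom φ ψ ?_ ?_)
  · exact ((hA' A').2 x' hx').unique (by rw [F.map_comp, hψ, hφ]) (F.map_id x')
  · exact ((hA A).2 x hx).unique (by rw [F.map_comp, hφ, hψ]) (F.map_id x)

theorem hasClass_pt : (pt K).HasClass (fun _ _ _ _ => True) 1 :=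
  ⟨K, _, _, inferInstance, PUnit.unit, KVariety.cls_spec_self K, fun B _ _ =>
    ⟨fun _ => trivial, fun _ _ => ⟨Algebra.ofId K B, rfl, fun _ _ => Subsingleton.elim _ _⟩⟩⟩

theorem represents_pow_line (ι : Type) :
    ((line K).pow ι).Represents (fun _ _ _ _ => True) (MvPolynomial ι K) MvPolynomial.X :=
  fun B _ _ => ⟨fun _ => trivial, fun y _ => ⟨MvPolynomial.aeval y, by
      funext i
      exact MvPolynomial.aeval_X y i, fun φ hφ => by
      refine MvPolynomial.algHom_ext fun i => ?_
      rw [MvPolynomial.aeval_X]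
      exact congrFun hφ i⟩⟩

theorem hasClass_pow_line (ι : Type) [Finite ι] :
    ((line K).pow ι).HasClass (fun _ _ _ _ => True)
      (KVariety.spec K (MvPolynomial ι K)).cls :=
  ⟨MvPolynomial ι K, _, _, inferInstance, MvPolynomial.X, rfl, represents_pow_line ι⟩

theorem HasClass.prod {Φ : F.Cond} {Ψ : G.Cond} {c d : GrothendieckRing K}
    (h : F.HasClass Φ c) (h' : G.HasClass Ψ d) :
    (F.prod G).HasClass (fun B _ _ x => Φ B x.1 ∧ Ψ B x.2) (c * d) := by
  obtain ⟨A, _, _, _, x, rfl, hA⟩ := h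
  obtain ⟨A', _, _, _, x', rfl, hA'⟩ := h'
  refine ⟨TensorProduct K A A', _, _, inferInstance,
    (F.map Algebra.TensorProduct.includeLeft x, G.map Algebra.TensorProduct.includeRight x'),
    KVariety.cls_spec_tensorProduct, fun B _ _ => ⟨fun φ => ?_, fun y hy => ?_⟩⟩
  · simp only [← F.map_comp, ← G.map_comp]
    exact ⟨(hA B).1 _, (hA' B).1 _⟩
  · obtain ⟨y, y'⟩ := y
    obtain ⟨φ, hφ, hu⟩ := (hA B).2 y hy.1
    obtain ⟨φ', hφ', hu'⟩ := (hA' B).2 y' hy.2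
    have hl : (Algebra.TensorProduct.lift φ φ' fun _ _ => Commute.all _ _).comp
        Algebra.TensorProduct.includeLeft = φ := Algebra.TensorProduct.lift_comp_includeLeft _ _ _
    have hr : (Algebra.TensorProduct.lift φ φ' fun _ _ => Commute.all _ _).comp
        Algebra.TensorProduct.includeRight = φ' :=
      Algebra.TensorProduct.lift_comp_includeRight φ φ' fun _ _ => Commute.all _ _
    refine ⟨Algebra.TensorProduct.lift φ φ' (fun _ _ => Commute.all _ _), ?_, fun ψ hψ => ?_⟩
    · simp only [← F.map_comp, ← G.map_comp]
      rw [hl, hr, hφ, hφ']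
    · simp only [← F.map_comp, ← G.map_comp, Prod.mk.injEq] at hψ
      refine Algebra.TensorProduct.ext ?_ ?_
      · rw [hl]
        exact hu _ hψ.1
      · exact (hu' _ hψ.2).trans hr.symm

section

variable {A : Type u} [CommRing A] [Algebra K A] {Φ : F.Cond} {x : F.obj A}

/-- The universal property of localization: a point factors through `Localization.Away` exactly when
`f` is a unit at it. The next lemma is the analogue for the quotient and the vanishing of `f`. -/
theorem Represents.isUnit (hA : F.Represents Φ A x) (f : F.Fun) (hf : NatFun f) :
    F.Represents (fun B _ _ x => Φ B x ∧ IsUnit (f B x)) (Localization.Away (f A x))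
      (F.map (IsScalarTower.toAlgHom K A (Localization.Away (f A x))) x) := by
  set a : A := f A x
  have hfa : ∀ {B : Type u} [CommRing B] [Algebra K B] (φ : A →ₐ[K] B),
      f B (F.map φ x) = φ a := fun φ => hf φ x
  refine fun B _ _ => ⟨fun φ => ?_, fun y hy => ?_⟩
  · rw [← F.map_comp]
    refine ⟨(hA B).1 _, ?_⟩
    rw [hfa]
    exact (IsLocalization.Away.algebraMap_isUnit a).map φ
  · obtain ⟨φ, rfl, hu⟩ := (hA B).2 y hy.1
    have hunit : IsUnit (φ a) := by
      rw [← hfa]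
      exact hy.2
    refine ⟨IsLocalization.liftAlgHom (M := Submonoid.powers a) (f := φ) ?_, ?_, fun ψ hψ => ?_⟩
    · rintro ⟨_, n, rfl⟩
      simpa using hunit.pow n
    · simp only [← F.map_comp]
      congr 1
      ext z
      simp
    · simp only [← F.map_comp] at hψ
      have := hu _ hψ
      refine IsLocalization.algHom_ext (Submonoid.powers a) ?_
      ext z
      have hz : ψ (algebraMap A (Localization.Away a) z) = φ z := DFunLike.congr_fun this z
      change ψ (algebraMap A (Localization.Away a) z) =
        IsLocalization.liftAlgHom _ (algebraMap A (Localization.Away a) z)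
      simp [hz]

theorem Represents.eq_zero (hA : F.Represents Φ A x) (f : F.Fun) (hf : NatFun f) :
    F.Represents (fun B _ _ x => Φ B x ∧ f B x = 0) (A ⧸ Ideal.span {f A x})
      (F.map (Ideal.Quotient.mkₐ K (Ideal.span {f A x})) x) := by
  set a : A := f A x
  have hfa : ∀ {B : Type u} [CommRing B] [Algebra K B] (φ : A →ₐ[K] B),
      f B (F.map φ x) = φ a := fun φ => hf φ x
  refine fun B _ _ => ⟨fun φ => ?_, fun y hy => ?_⟩
  · rw [← F.map_comp]
    refine ⟨(hA B).1 _, ?_⟩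
    rw [hfa, AlgHom.comp_apply]
    have : Ideal.Quotient.mkₐ K (Ideal.span {a}) a = 0 :=
      Ideal.Quotient.eq_zero_iff_mem.2 (Ideal.mem_span_singleton_self a)
    rw [this, map_zero]
  · obtain ⟨φ, rfl, hu⟩ := (hA B).2 y hy.1
    have hzero : φ a = 0 := by
      rw [← hfa]
      exact hy.2
    refine ⟨Ideal.Quotient.liftₐ (Ideal.span {a}) φ ?_, ?_, fun ψ hψ => ?_⟩
    · intro z hz
      obtain ⟨w, rfl⟩ := Ideal.mem_span_singleton'.1 hz
      simp [hzero]
    · simp only [← F.map_comp]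
      congr 1
    · simp only [← F.map_comp] at hψ
      have := hu _ hψ
      refine Ideal.Quotient.algHom_ext _ ?_
      rw [this]
      rfl

end

theorem HasClass.split {Φ : F.Cond} {c : GrothendieckRing K} (h : F.HasClass Φ c)
    (f : F.Fun) (hf : NatFun f) :
    ∃ c₁ c₂, F.HasClass (fun B _ _ x => Φ B x ∧ IsUnit (f B x)) c₁ ∧
      F.HasClass (fun B _ _ x => Φ B x ∧ f B x = 0) c₂ ∧ c = c₁ + c₂ := by
  obtain ⟨A, _, _, _, x, rfl, hA⟩ := h
  exact ⟨_, _, ⟨_, _, _, inferInstance, _, rfl, hA.isUnit f hf⟩,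
    ⟨_, _, _, inferInstance, _, rfl, hA.eq_zero f hf⟩, KVariety.cls_spec_scissor (f A x)⟩

/-- The condition `Φ` cuts out an affine variety. -/
def IsAffine (F : PointFunctor K) (Φ : F.Cond) : Prop := ∃ c, F.HasClass Φ c

theorem IsAffine.isUnit {Φ : F.Cond} (h : F.IsAffine Φ) (f : F.Fun)
    (hf : NatFun f) : F.IsAffine (fun B _ _ x => Φ B x ∧ IsUnit (f B x)) := by
  obtain ⟨c, hc⟩ := h
  obtain ⟨c₁, c₂, h₁, -, -⟩ := hc.split f hf
  exact ⟨c₁, h₁⟩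

theorem IsAffine.eq_zero {Φ : F.Cond} (h : F.IsAffine Φ) (f : F.Fun)
    (hf : NatFun f) : F.IsAffine (fun B _ _ x => Φ B x ∧ (f B x) = 0) := by
  obtain ⟨c, hc⟩ := h
  obtain ⟨c₁, c₂, -, h₂, -⟩ := hc.split f hf
  exact ⟨c₂, h₂⟩

/-- The main tool for computing classes by stratification. Affineness of the whole locus has to be
known beforehand; the strata then determine its class. -/
theorem IsAffine.hasClass_add {Φ : F.Cond} (h : F.IsAffine Φ) (f : F.Fun)
    (hf : NatFun f) {c₁ c₂ : GrothendieckRing K}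
    (h₁ : F.HasClass (fun B _ _ x => Φ B x ∧ IsUnit (f B x)) c₁)
    (h₂ : F.HasClass (fun B _ _ x => Φ B x ∧ (f B x) = 0) c₂) :
    F.HasClass Φ (c₁ + c₂) := by
  obtain ⟨c, hc⟩ := h
  obtain ⟨c₁', c₂', h₁', h₂', rfl⟩ := hc.split f hf
  rwa [h₁.unique h₁', h₂.unique h₂']

end PointFunctor

/-! ### Classes of the line, the torus and the banana loci -/

namespace PointFunctor

variable {K : Type u} [Field K] {F G : PointFunctor K}

theorem HasClass.isAffine {Φ : F.Cond} {c : GrothendieckRing K} (h : F.HasClass Φ c) :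
    F.IsAffine Φ := ⟨c, h⟩

theorem IsAffine.congr {Φ Ψ : F.Cond} (h : F.IsAffine Φ)
    (hΦ : ∀ (B : Type u) [CommRing B] [Algebra K B] (x : F.obj B), Φ B x ↔ Ψ B x) :
    F.IsAffine Ψ :=
  h.imp fun _ hc => hc.congr hΦ

/-- The inverse `g` need not be natural on all points, so it may be written with `Ring.inverse`,
which ring homomorphisms do not respect at non-units. -/
theorem IsAffine.hasClass_of_inverse {Φ : F.Cond} {Ψ : G.Cond} {c : GrothendieckRing K}
    (h : F.IsAffine Φ) (h' : G.HasClass Ψ c) (f : F.Trans G) (hf : Natural f) (g : G.Trans F)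
    (hfm : ∀ (B : Type u) [CommRing B] [Algebra K B] (x : F.obj B), Φ B x → Ψ B (f B x))
    (hgm : ∀ (B : Type u) [CommRing B] [Algebra K B] (y : G.obj B), Ψ B y → Φ B (g B y))
    (hfg : ∀ (B : Type u) [CommRing B] [Algebra K B] (y : G.obj B), Ψ B y → f B (g B y) = y)
    (hgf : ∀ (B : Type u) [CommRing B] [Algebra K B] (x : F.obj B), Φ B x → g B (f B x) = x) :
    F.HasClass Φ c := by
  obtain ⟨d, hd⟩ := h
  have : G.HasClass Ψ d := hd.of_bijOn f hf (fun B _ _ x hx => hfm B x hx) fun B _ _ y hy =>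
    ⟨g B y, ⟨hgm B y hy, hfg B y hy⟩, fun x hx => by rw [← hx.2, hgf B x hx.1]⟩
  rwa [h'.unique this]

theorem lefschetz_eq_add (K : Type u) [Field K] : lefschetz K = torusClass K + 1 := by
  simp [torusClass]

theorem hasClass_line : (line K).HasClass (fun _ _ _ _ => True) (lefschetz K) := by
  refine (hasClass_pow_line Unit).of_bijOn (fun B _ _ x => x ())
    (fun B C _ _ _ _ φ x => rfl) (fun _ _ _ _ _ => trivial) fun B _ _ y _ =>
      ⟨fun _ => y, ⟨trivial, rfl⟩, ?_⟩
  rintro x ⟨-, rfl⟩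
  rfl

theorem hasClass_line_eq_zero : (line K).HasClass (fun _ _ _ x => x = 0) 1 := by
  refine hasClass_pt.of_bijOn (fun B _ _ _ => (0 : B)) (fun B C _ _ _ _ φ x => ?_)
    (fun _ _ _ _ _ => rfl) fun B _ _ y hy => ⟨PUnit.unit, ⟨trivial, hy.symm⟩, fun _ _ => rfl⟩
  exact (map_zero φ).symm

theorem hasClass_line_isUnit : (line K).HasClass (fun _ _ _ x => IsUnit x) (torusClass K) := by
  obtain ⟨c₁, c₂, h₁, h₂, h⟩ := hasClass_line.split (K := K) (fun B _ _ x => x)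
    fun B C _ _ _ _ φ x => rfl
  have h₃ : c₂ = 1 := (h₂.congr fun B _ _ x => by simp).unique hasClass_line_eq_zero
  have h₄ : torusClass K = c₁ := by
    rw [torusClass, h, h₃, add_sub_cancel_right]
  rw [h₄]
  exact h₁.congr fun B _ _ x => by simp

/-- The complement of the hypersurface of the `3`-banana graph. -/
theorem hasClass_banana_isUnit :
    ((line K).prod ((line K).prod (line K))).HasClass
      (fun B _ _ x => IsUnit (x.1 * x.2.1 + (x.1 + x.2.1) * x.2.2 : B))
      (torusClass K * lefschetz K ^ 2) := by
  have haff : ((line K).prod ((line K).prod (line K))).IsAffine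
      (fun B _ _ x => IsUnit (x.1 * x.2.1 + (x.1 + x.2.1) * x.2.2 : B)) :=
    ((hasClass_line.prod (hasClass_line.prod hasClass_line)).isAffine.isUnit
      (fun B _ _ x => (x.1 * x.2.1 + (x.1 + x.2.1) * x.2.2 : B))
      fun B C _ _ _ _ φ x => by simp).congr fun B _ _ x => by simp
  have hnat : NatFun (F := (line K).prod ((line K).prod (line K)))
      (fun B _ _ x => (x.1 + x.2.1 : B)) := fun B C _ _ _ _ φ x => by simp
  have h : torusClass K * lefschetz K ^ 2 = lefschetz K * (torusClass K * torusClass K) +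
      torusClass K * (lefschetz K * 1) := by
    rw [lefschetz_eq_add]
    ring
  rw [h]
  -- If `a + b` is a unit, the polynomial can replace `z` as a coordinate. If `a + b = 0`, the
  -- polynomial is `-a ^ 2` and `z` is free.
  refine haff.hasClass_add (fun B _ _ x => (x.1 + x.2.1 : B)) hnat ?_ ?_
  · refine (haff.isUnit _ hnat).hasClass_of_inverse
      (hasClass_line.prod (hasClass_line_isUnit.prod hasClass_line_isUnit))
      (fun B _ _ x => ((x.1, x.1 + x.2.1, x.1 * x.2.1 + (x.1 + x.2.1) * x.2.2) : B × B × B))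
      (fun B C _ _ _ _ φ x => by simp)
      (fun B _ _ y => ((y.1, y.2.1 - y.1,
        (y.2.2 - y.1 * (y.2.1 - y.1)) * Ring.inverse y.2.1) : B × B × B)) ?_ ?_ ?_ ?_
    · rintro B _ _ ⟨a, b, z⟩ ⟨h₁, h₂⟩
      exact ⟨trivial, h₂, h₁⟩
    · rintro B _ _ ⟨a, b, z⟩ ⟨-, h₁, h₂⟩
      have := Ring.inverse_mul_cancel _ h₁
      have e : a * (b - a) + (a + (b - a)) * ((z - a * (b - a)) * Ring.inverse b) = z := by
        linear_combination (z - a * (b - a)) * this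
      exact ⟨by simpa only [e] using h₂, by simpa using h₁⟩
    · rintro B _ _ ⟨a, b, z⟩ ⟨-, h₁, h₂⟩
      have := Ring.inverse_mul_cancel _ h₁
      simp only [Prod.mk.injEq, true_and]
      exact ⟨by ring, by linear_combination (z - a * (b - a)) * this⟩
    · rintro B _ _ ⟨a, b, z⟩ ⟨h₁, h₂⟩
      have := Ring.inverse_mul_cancel _ h₂
      simp only [Prod.mk.injEq, true_and]
      exact ⟨by ring, by linear_combination z * this⟩
  · refine (haff.eq_zero _ hnat).hasClass_of_inverse
      (hasClass_line_isUnit.prod (hasClass_line.prod hasClass_line_eq_zero))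
      (fun B _ _ x => ((x.1, x.2.2, x.1 + x.2.1) : B × B × B))
      (fun B C _ _ _ _ φ x => by simp)
      (fun B _ _ y => ((y.1, y.2.2 - y.1, y.2.1) : B × B × B)) ?_ ?_ ?_ ?_
    · rintro B _ _ ⟨a, b, z⟩ ⟨h₁, h₂⟩
      simp only at h₁ h₂
      rw [h₂, zero_mul, add_zero] at h₁
      exact ⟨isUnit_of_mul_isUnit_left h₁, trivial, h₂⟩
    · rintro B _ _ ⟨a, z, b⟩ ⟨h₁, -, h₂⟩
      obtain rfl : b = 0 := h₂
      have h₁ : IsUnit a := h₁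
      simpa using h₁
    · rintro B _ _ ⟨a, z, b⟩ -
      simp
    · rintro B _ _ ⟨a, b, z⟩ -
      simp

theorem hasClass_isUnit_add_one :
    (line K).HasClass (fun _ _ _ x => IsUnit x ∧ IsUnit (x + 1)) (torusClass K - 1) := by
  obtain ⟨c₁, c₂, h₁, h₂, h⟩ := hasClass_line_isUnit.split (K := K) (fun B _ _ x => x + 1)
    fun B C _ _ _ _ φ x => by simp
  have h₃ : c₂ = 1 := by
    refine h₂.unique (h₂.isAffine.hasClass_of_inverse hasClass_line_eq_zero
      (fun B _ _ x => x + 1) (fun B C _ _ _ _ φ x => by simp) (fun B _ _ x => x - 1) ?_ ?_ ?_ ?_)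
    · rintro B _ _ x ⟨-, h⟩
      exact h
    · rintro B _ _ x rfl
      simp
    · simp
    · simp
  rw [h, h₃, add_sub_cancel_right]
  exact h₁

/-- Substituting `a = w * b` turns the condition on `a + b` into one on `w + 1`, which splits the
locus as a product. -/
theorem hasClass_isUnit_add :
    ((line K).prod (line K)).HasClass
      (fun B _ _ x => IsUnit (x.1 : B) ∧ IsUnit (x.2 : B) ∧ IsUnit (x.1 + x.2 : B))
      (torusClass K * (torusClass K - 1)) := by
  refine (hasClass_line_isUnit.prod hasClass_isUnit_add_one).of_bijOn
    (fun B _ _ x => ((x.2 * x.1, x.1) : B × B)) (fun B C _ _ _ _ φ x => by simp) ?_ ?_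
  · rintro B _ _ ⟨b, w⟩ ⟨h₁, h₂, h₃⟩
    refine ⟨h₂.mul h₁, h₁, ?_⟩
    have : w * b + b = (w + 1) * b := by ring
    simpa only [this] using h₃.mul h₁
  · rintro B _ _ ⟨a, b⟩ ⟨h₁, h₂, h₃⟩
    have hb := Ring.inverse_mul_cancel _ h₂
    have e : a * Ring.inverse b * b = a := by linear_combination a * hb
    refine ⟨(b, a * Ring.inverse b), ⟨⟨h₂, h₁.mul h₂.ringInverse, ?_⟩, by simp only [e]⟩, ?_⟩
    · have : a * Ring.inverse b + 1 = (a + b) * Ring.inverse b := by linear_combination -hb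
      simpa only [this] using h₃.mul h₂.ringInverse
    · rintro ⟨b', w⟩ ⟨-, h⟩
      simp only [Prod.mk.injEq] at h ⊢
      obtain ⟨rfl, rfl⟩ := h
      exact ⟨rfl, by linear_combination -w * hb⟩

/-- On this locus `(a + b) * z = -(a * b)` is a unit, so `a + b` is one too and `z` is determined by
`a` and `b`. -/
theorem hasClass_banana_eq_zero :
    ((line K).prod ((line K).prod (line K))).HasClass
      (fun B _ _ x => (x.1 * x.2.1 + (x.1 + x.2.1) * x.2.2 : B) = 0 ∧
        IsUnit (x.1 * x.2.1 * x.2.2 : B))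
      (torusClass K * (torusClass K - 1)) := by
  have haff : ((line K).prod ((line K).prod (line K))).IsAffine
      (fun B _ _ x => (x.1 * x.2.1 + (x.1 + x.2.1) * x.2.2 : B) = 0 ∧
        IsUnit (x.1 * x.2.1 * x.2.2 : B)) :=
    (((hasClass_line.prod (hasClass_line.prod hasClass_line)).isAffine.eq_zero
      (fun B _ _ x => (x.1 * x.2.1 + (x.1 + x.2.1) * x.2.2 : B))
      fun B C _ _ _ _ φ x => by simp).isUnit
      (fun B _ _ x => (x.1 * x.2.1 * x.2.2 : B))
      fun B C _ _ _ _ φ x => by simp).congr fun B _ _ x => by simp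
  have key : ∀ {B : Type u} [CommRing B] {a b z : B},
      a * b + (a + b) * z = 0 → IsUnit (a * b * z) →
        IsUnit a ∧ IsUnit b ∧ IsUnit z ∧ IsUnit (a + b) := by
    intro B _ a b z h₁ h₂
    simp only [IsUnit.mul_iff] at h₂
    refine ⟨h₂.1.1, h₂.1.2, h₂.2, isUnit_of_mul_isUnit_left (y := z) ?_⟩
    rw [← neg_eq_of_add_eq_zero_right h₁]
    exact (h₂.1.1.mul h₂.1.2).neg
  refine haff.hasClass_of_inverse hasClass_isUnit_add (fun B _ _ x => ((x.1, x.2.1) : B × B))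
    (fun B C _ _ _ _ φ x => rfl)
    (fun B _ _ x => ((x.1, x.2, -(x.1 * x.2) * Ring.inverse (x.1 + x.2)) : B × B × B)) ?_ ?_ ?_ ?_
  · rintro B _ _ ⟨a, b, z⟩ ⟨h₁, h₂⟩
    obtain ⟨h₃, h₄, -, h₅⟩ := key h₁ h₂
    exact ⟨h₃, h₄, h₅⟩
  · rintro B _ _ ⟨a, b⟩ ⟨h₁, h₂, h₃⟩
    have h := Ring.inverse_mul_cancel _ h₃
    exact ⟨by linear_combination -(a * b) * h,
      (h₁.mul h₂).mul ((h₁.mul h₂).neg.mul h₃.ringInverse)⟩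
  · rintro B _ _ ⟨a, b⟩ -
    rfl
  · rintro B _ _ ⟨a, b, z⟩ ⟨h₁, h₂⟩
    obtain ⟨-, -, -, h₅⟩ := key h₁ h₂
    have h := Ring.inverse_mul_cancel _ h₅
    have h₁ : a * b + (a + b) * z = 0 := h₁
    simp only [Prod.mk.injEq, true_and]
    linear_combination z * h - Ring.inverse (a + b) * h₁

end PointFunctor

/-! ### The two classes of a pair `(P, Q)` under series and node operations -/

namespace PointFunctor

variable {K : Type u} [Field K] {F G : PointFunctor K}

theorem IsAffine.isUnit_of_univ (h : F.IsAffine fun _ _ _ _ => True) {R : F.Fun}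
    (hR : NatFun R) : F.IsAffine (fun B _ _ x => IsUnit (R B x)) :=
  (h.isUnit R hR).congr fun B _ _ x => by simp

theorem IsAffine.eq_zero_of_univ (h : F.IsAffine fun _ _ _ _ => True) {R S : F.Fun}
    (hR : NatFun R) (hS : NatFun S) :
    F.IsAffine (fun B _ _ x => R B x = 0 ∧ IsUnit (S B x)) :=
  ((h.eq_zero R hR).isUnit S hS).congr fun B _ _ x => by simp

/-- The classes of the loci `P ≠ 0` and `P = 0 ≠ Q` for a pair of functions `P`, `Q`. -/
structure PairClass (F : PointFunctor K) (P Q : F.Fun) (p m : GrothendieckRing K) : Prop where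
  natP : NatFun P
  natQ : NatFun Q
  isAffine : F.IsAffine (fun _ _ _ _ => True)
  hasClass_isUnit : F.HasClass (fun B _ _ x => IsUnit (P B x)) p
  hasClass_eq_zero : F.HasClass (fun B _ _ x => P B x = 0 ∧ IsUnit (Q B x)) m

namespace PairClass

variable {P Q : F.Fun} {p m : GrothendieckRing K}

/-- The pair of the network with no edges and coinciding terminals, the start of both recursions. -/
theorem trivial : PairClass (pt K) (fun _ _ _ _ => 1) (fun _ _ _ _ => 0) 1 0 where
  natP _ _ _ _ _ _ φ _ := (map_one φ).symm
  natQ _ _ _ _ _ _ φ _ := (map_zero φ).symm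
  isAffine := hasClass_pt.isAffine
  hasClass_isUnit := hasClass_pt.congr fun B _ _ _ => by simp
  hasClass_eq_zero := by
    -- The locus is empty but has points over the zero ring. Its class vanishes because splitting
    -- the point along the function `1` gives `1 = 1 + c₂`.
    obtain ⟨c₁, c₂, h₁, h₂, h⟩ := hasClass_pt.split (K := K) (fun B _ _ _ => 1)
      fun B C _ _ _ _ φ _ => (map_one φ).symm
    have h₃ : c₁ = 1 := (h₁.congr fun B _ _ x => by simp).unique hasClass_pt
    have h₄ : c₂ = 0 := by
      rw [h₃] at h
      simpa using h
    rw [← h₄]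
    refine h₂.congr fun B _ _ x => ?_
    simp only [true_and, isUnit_zero_iff]
    exact ⟨fun h => ⟨h, h.symm⟩, fun h => h.1⟩

/-- Adding an edge in series: the locus where the second function is invertible. -/
theorem hasClass_series_edge (h : PairClass F P Q p m) :
    ((line K).prod F).HasClass (fun B _ _ x => IsUnit (Q B x.2 + x.1 * P B x.2 : B))
      (torusClass K * p + lefschetz K * m) := by
  have hP : NatFun (F := (line K).prod F) (fun B _ _ x => P B x.2) :=
    fun B C _ _ _ _ φ x => h.natP φ x.2
  have hQ : NatFun (F := (line K).prod F) (fun B _ _ x => (Q B x.2 + x.1 * P B x.2 : B)) :=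
    fun B C _ _ _ _ φ x => by simp [h.natP φ x.2, h.natQ φ x.2]
  have haff : ((line K).prod F).IsAffine
      (fun B _ _ x => IsUnit (Q B x.2 + x.1 * P B x.2 : B)) := by
    obtain ⟨c, hc⟩ := h.isAffine
    exact ((hasClass_line.prod hc).isAffine.isUnit _ hQ).congr fun B _ _ x => by simp
  -- Where `P` is a unit, the edge variable can be exchanged for the value `Q + d * P`; where `P =
  -- 0`, it is free and `Q` must be a unit.
  refine haff.hasClass_add _ hP ?_ ?_
  · refine (haff.isUnit _ hP).hasClass_of_inverse
      (hasClass_line_isUnit.prod h.hasClass_isUnit)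
      (fun B _ _ x => (Q B x.2 + x.1 * P B x.2, x.2))
      (fun B C _ _ _ _ φ x => by simp [h.natP φ x.2, h.natQ φ x.2])
      (fun B _ _ x => ((x.1 - Q B x.2) * Ring.inverse (P B x.2), x.2)) ?_ ?_ ?_ ?_
    · rintro B _ _ ⟨d, x⟩ hx
      exact hx
    · rintro B _ _ ⟨d, x⟩ ⟨h₁, h₂⟩
      have e := Ring.inverse_mul_cancel _ h₂
      refine ⟨?_, h₂⟩
      have : Q B x + (d - Q B x) * Ring.inverse (P B x) * P B x = d := by
        linear_combination (d - Q B x) * e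
      simpa only [this] using h₁
    · rintro B _ _ ⟨d, x⟩ ⟨h₁, h₂⟩
      have e := Ring.inverse_mul_cancel _ h₂
      simp only [Prod.mk.injEq, and_true]
      linear_combination (d - Q B x) * e
    · rintro B _ _ ⟨d, x⟩ ⟨h₁, h₂⟩
      have e := Ring.inverse_mul_cancel _ h₂
      simp only [Prod.mk.injEq, and_true]
      linear_combination d * e
  · refine (hasClass_line.prod h.hasClass_eq_zero).congr fun B _ _ x => ?_
    constructor
    · rintro ⟨-, h₁, h₂⟩
      simp [h₁, h₂]
    · rintro ⟨h₁, h₂⟩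
      simpa [h₂] using h₁

/-- Adding an edge in series. -/
theorem series_edge (h : PairClass F P Q p m) :
    PairClass ((line K).prod F) (fun B _ _ x => P B x.2)
      (fun B _ _ x => (Q B x.2 + x.1 * P B x.2 : B)) (lefschetz K * p) (lefschetz K * m) where
  natP B C _ _ _ _ φ x := h.natP φ x.2
  natQ B C _ _ _ _ φ x := by simp [h.natP φ x.2, h.natQ φ x.2]
  isAffine := by
    obtain ⟨c, hc⟩ := h.isAffine
    exact (hasClass_line.prod hc).isAffine.congr fun B _ _ x => by simp
  hasClass_isUnit := (hasClass_line.prod h.hasClass_isUnit).congr fun B _ _ x => by simp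
  hasClass_eq_zero := by
    refine (hasClass_line.prod h.hasClass_eq_zero).congr fun B _ _ x => ?_
    constructor
    · rintro ⟨-, h₁, h₂⟩
      exact ⟨h₁, by simpa [h₁] using h₂⟩
    · rintro ⟨h₁, h₂⟩
      exact ⟨True.intro, h₁, by simpa [h₁] using h₂⟩

/-- Putting two networks in series. -/
theorem series {P' Q' : G.Fun} {p' m' : GrothendieckRing K} (h : PairClass F P Q p m)
    (h' : PairClass G P' Q' p' m') :
    PairClass (F.prod G) (fun B _ _ x => P B x.1 * P' B x.2)
      (fun B _ _ x => Q B x.1 * P' B x.2 + P B x.1 * Q' B x.2) (p * p') (p * m' + m * p') := by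
  have natP : NatFun (F := F.prod G) (fun B _ _ x => P B x.1 * P' B x.2) :=
    fun B C _ _ _ _ φ x => by simp [h.natP φ x.1, h'.natP φ x.2]
  have natQ : NatFun (F := F.prod G) (fun B _ _ x => Q B x.1 * P' B x.2 + P B x.1 * Q' B x.2) :=
    fun B C _ _ _ _ φ x => by
      simp [h.natP φ x.1, h'.natP φ x.2, h.natQ φ x.1, h'.natQ φ x.2]
  have isAffine : (F.prod G).IsAffine (fun _ _ _ _ => True) := by
    obtain ⟨c, hc⟩ := h.isAffine
    obtain ⟨c', hc'⟩ := h'.isAffine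
    exact (hc.prod hc').isAffine.congr fun B _ _ x => by simp
  refine ⟨natP, natQ, isAffine, ?_, ?_⟩
  · exact (h.hasClass_isUnit.prod h'.hasClass_isUnit).congr fun B _ _ x => IsUnit.mul_iff.symm
  · have haff := isAffine.eq_zero_of_univ natP natQ
    have hP : NatFun (F := F.prod G) (fun B _ _ x => P B x.1) := fun B C _ _ _ _ φ x => h.natP φ x.1
    -- If `P * P' = 0` while `Q * P' + P * Q'` is a unit, exactly one of `P`, `P'` vanishes; the
    -- strata are told apart by `P`.
    refine haff.hasClass_add _ hP
      ((h.hasClass_isUnit.prod h'.hasClass_eq_zero).congr fun B _ _ x => ?_)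
      ((h.hasClass_eq_zero.prod h'.hasClass_isUnit).congr fun B _ _ x => ?_)
    · constructor
      · rintro ⟨h₁, h₂, h₃⟩
        simp [h₁, h₂, h₃]
      · rintro ⟨⟨h₁, h₂⟩, h₃⟩
        have h₄ : P' B x.2 = 0 := (h₃.mul_right_eq_zero).1 h₁
        refine ⟨h₃, h₄, ?_⟩
        simpa [h₄, h₃] using h₂
    · constructor
      · rintro ⟨⟨h₁, h₂⟩, h₃⟩
        simp [h₁, h₂, h₃]
      · rintro ⟨⟨-, h₂⟩, h₃⟩
        simpa [h₃] using h₂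

theorem add_sub_mul_inverse_mul {B : Type u} [CommRing B] {p q z : B} (hp : IsUnit p) :
    q + (z - q) * Ring.inverse p * p = z := by
  linear_combination (z - q) * Ring.inverse_mul_cancel _ hp

/-- Undoing the rescaling: at the variables recovered from banana coordinates, the node polynomial
is the banana polynomial divided by `p`. -/
theorem node_inverse_eq {B : Type u} [CommRing B] {a b p q z : B} (hp : IsUnit p) :
    a * Ring.inverse p * (b * Ring.inverse p) * p + (a * Ring.inverse p + b * Ring.inverse p) *
      (q + (z - q) * Ring.inverse p * p) = Ring.inverse p * (a * b + (a + b) * z) := by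
  rw [add_sub_mul_inverse_mul hp]
  linear_combination a * b * Ring.inverse p * Ring.inverse_mul_cancel _ hp

/-- Adding an edge `c` in series and then two edges `a`, `b` in parallel. -/
theorem node (h : PairClass F P Q p m) :
    PairClass (((line K).prod ((line K).prod (line K))).prod F)
      (fun B _ _ x => (x.1.1 * x.1.2.1 * P B x.2 +
        (x.1.1 + x.1.2.1) * (Q B x.2 + x.1.2.2 * P B x.2) : B))
      (fun B _ _ x => (x.1.1 * x.1.2.1 * (Q B x.2 + x.1.2.2 * P B x.2) : B))
      (torusClass K * lefschetz K ^ 2 * (p + m))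
      (torusClass K * ((torusClass K - 1) * p + lefschetz K * m)) := by
  have hP : NatFun (F := ((line K).prod ((line K).prod (line K))).prod F)
    (fun B _ _ x => P B x.2) := fun B C _ _ _ _ φ x => h.natP φ x.2
  -- The coordinates `a * P`, `b * P`, `Q + c * P` are those in which `P` times the node polynomial
  -- is the banana polynomial.
  have hf : Natural (F := ((line K).prod ((line K).prod (line K))).prod F)
      (G := ((line K).prod ((line K).prod (line K))).prod F) (fun B _ _ x =>
        (((x.1.1 * P B x.2, x.1.2.1 * P B x.2, Q B x.2 + x.1.2.2 * P B x.2), x.2) :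
          (B × B × B) × F.obj B)) :=
    fun B C _ _ _ _ φ x => by simp [h.natP φ x.2, h.natQ φ x.2]
  have natP : NatFun (F := ((line K).prod ((line K).prod (line K))).prod F)
      (fun B _ _ x => (x.1.1 * x.1.2.1 * P B x.2 +
        (x.1.1 + x.1.2.1) * (Q B x.2 + x.1.2.2 * P B x.2) : B)) :=
    fun B C _ _ _ _ φ x => by simp [h.natP φ x.2, h.natQ φ x.2]
  have natQ : NatFun (F := ((line K).prod ((line K).prod (line K))).prod F)
      (fun B _ _ x => (x.1.1 * x.1.2.1 * (Q B x.2 + x.1.2.2 * P B x.2) : B)) :=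
    fun B C _ _ _ _ φ x => by simp [h.natP φ x.2, h.natQ φ x.2]
  have isAffine : (((line K).prod ((line K).prod (line K))).prod F).IsAffine
      (fun _ _ _ _ => True) := by
    obtain ⟨c, hc⟩ := h.isAffine
    exact ((hasClass_line.prod (hasClass_line.prod hasClass_line)).prod hc).isAffine.congr
      fun B _ _ x => by simp
  refine ⟨natP, natQ, isAffine, ?_, ?_⟩
  · have haff := isAffine.isUnit_of_univ natP
    have e : torusClass K * lefschetz K ^ 2 * (p + m) = torusClass K * lefschetz K ^ 2 * p +
      torusClass K * (lefschetz K * lefschetz K) * m := by ring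
    rw [e]
    refine haff.hasClass_add _ hP ?_ ?_
    · refine (haff.isUnit _ hP).hasClass_of_inverse
        (hasClass_banana_isUnit.prod h.hasClass_isUnit) _ hf
        (fun B _ _ x => ((x.1.1 * Ring.inverse (P B x.2), x.1.2.1 * Ring.inverse (P B x.2),
          (x.1.2.2 - Q B x.2) * Ring.inverse (P B x.2)), x.2)) ?_ ?_ ?_ ?_
      · rintro B _ _ ⟨⟨a, b, c⟩, x⟩ ⟨h₁, h₂⟩
        refine ⟨?_, h₂⟩
        have : a * P B x * (b * P B x) + (a * P B x + b * P B x) * (Q B x + c * P B x) =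
          P B x * (a * b * P B x + (a + b) * (Q B x + c * P B x)) := by ring
        simpa only [this] using h₂.mul h₁
      · rintro B _ _ ⟨⟨a, b, z⟩, x⟩ ⟨h₁, h₂⟩
        refine ⟨?_, h₂⟩
        simp only [node_inverse_eq h₂]
        exact h₂.ringInverse.mul h₁
      · rintro B _ _ ⟨⟨a, b, z⟩, x⟩ ⟨-, h₂⟩
        have e := Ring.inverse_mul_cancel _ h₂
        simp only [Prod.mk.injEq, and_true]
        exact ⟨by linear_combination a * e, by linear_combination b * e,
          by linear_combination (z - Q B x) * e⟩
      · rintro B _ _ ⟨⟨a, b, c⟩, x⟩ ⟨-, h₂⟩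
        have e := Ring.inverse_mul_cancel _ h₂
        simp only [Prod.mk.injEq, and_true]
        exact ⟨by linear_combination a * e, by linear_combination b * e,
          by linear_combination c * e⟩
    -- For `P = 0` the polynomial reduces to `(a + b) * Q`, so `a + b` is taken as a coordinate.
    · refine (haff.eq_zero _ hP).hasClass_of_inverse
        ((hasClass_line_isUnit.prod (hasClass_line.prod hasClass_line)).prod h.hasClass_eq_zero)
        (fun B _ _ x => (((x.1.1 + x.1.2.1, x.1.2.1, x.1.2.2), x.2) : (B × B × B) × F.obj B))
        (fun B C _ _ _ _ φ x => by simp)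
        (fun B _ _ x => (((x.1.1 - x.1.2.1, x.1.2.1, x.1.2.2), x.2) : (B × B × B) × F.obj B))
        ?_ ?_ ?_ ?_
      · rintro B _ _ ⟨⟨a, b, c⟩, x⟩ ⟨h₁, h₂⟩
        have h₂ : P B x = 0 := h₂
        simp only [h₂, mul_zero, add_zero, zero_add, IsUnit.mul_iff] at h₁
        exact ⟨⟨h₁.1, True.intro, True.intro⟩, h₂, h₁.2⟩
      · rintro B _ _ ⟨⟨a, b, c⟩, x⟩ ⟨⟨h₁, -, -⟩, h₂, h₃⟩
        refine ⟨?_, h₂⟩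
        simp only [h₂, mul_zero, add_zero, zero_add, sub_add_cancel]
        exact h₁.mul h₃
      · rintro B _ _ ⟨⟨a, b, c⟩, x⟩ -
        simp
      · rintro B _ _ ⟨⟨a, b, c⟩, x⟩ -
        simp
  · have haff := isAffine.eq_zero_of_univ natP natQ
    have e : torusClass K * ((torusClass K - 1) * p + lefschetz K * m) =
      torusClass K * (torusClass K - 1) * p + 1 * (torusClass K * lefschetz K) * m := by ring
    rw [e]
    refine haff.hasClass_add _ hP ?_ ?_
    · refine (haff.isUnit _ hP).hasClass_of_inverse
        (hasClass_banana_eq_zero.prod h.hasClass_isUnit) _ hf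
        (fun B _ _ x => ((x.1.1 * Ring.inverse (P B x.2), x.1.2.1 * Ring.inverse (P B x.2),
          (x.1.2.2 - Q B x.2) * Ring.inverse (P B x.2)), x.2)) ?_ ?_ ?_ ?_
      · rintro B _ _ ⟨⟨a, b, c⟩, x⟩ ⟨⟨h₁, h₃⟩, h₂⟩
        have h₁ : a * b * P B x + (a + b) * (Q B x + c * P B x) = 0 := h₁
        refine ⟨⟨by linear_combination P B x * h₁, ?_⟩, h₂⟩
        have : a * P B x * (b * P B x) * (Q B x + c * P B x) =
          P B x * P B x * (a * b * (Q B x + c * P B x)) := by ring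
        simpa only [this] using (h₂.mul h₂).mul h₃
      · rintro B _ _ ⟨⟨a, b, z⟩, x⟩ ⟨⟨h₁, h₃⟩, h₂⟩
        refine ⟨⟨?_, ?_⟩, h₂⟩
        · simp only [node_inverse_eq h₂]
          exact mul_eq_zero_of_right _ h₁
        · simp only [add_sub_mul_inverse_mul h₂]
          have : a * Ring.inverse (P B x) * (b * Ring.inverse (P B x)) * z =
            Ring.inverse (P B x) * Ring.inverse (P B x) * (a * b * z) := by ring
          rw [this]
          exact (h₂.ringInverse.mul h₂.ringInverse).mul h₃
      · rintro B _ _ ⟨⟨a, b, z⟩, x⟩ ⟨-, h₂⟩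
        have e := Ring.inverse_mul_cancel _ h₂
        simp only [Prod.mk.injEq, and_true]
        exact ⟨by linear_combination a * e, by linear_combination b * e,
          by linear_combination (z - Q B x) * e⟩
      · rintro B _ _ ⟨⟨a, b, c⟩, x⟩ ⟨-, h₂⟩
        have e := Ring.inverse_mul_cancel _ h₂
        simp only [Prod.mk.injEq, and_true]
        exact ⟨by linear_combination a * e, by linear_combination b * e,
          by linear_combination c * e⟩
    -- For `P = 0` the conditions become `a + b = 0` with `b` and `Q` units; `c` stays free.
    · refine (haff.eq_zero _ hP).hasClass_of_inverse
        ((hasClass_line_eq_zero.prod (hasClass_line_isUnit.prod hasClass_line)).prod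
          h.hasClass_eq_zero)
        (fun B _ _ x => (((x.1.1 + x.1.2.1, x.1.2.1, x.1.2.2), x.2) : (B × B × B) × F.obj B))
        (fun B C _ _ _ _ φ x => by simp)
        (fun B _ _ x => (((x.1.1 - x.1.2.1, x.1.2.1, x.1.2.2), x.2) : (B × B × B) × F.obj B))
        ?_ ?_ ?_ ?_
      · rintro B _ _ ⟨⟨a, b, c⟩, x⟩ ⟨⟨h₁, h₃⟩, h₂⟩
        have h₂ : P B x = 0 := h₂
        simp only [h₂, mul_zero, add_zero, zero_add, IsUnit.mul_iff] at h₁ h₃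
        exact ⟨⟨(h₃.2.mul_left_eq_zero).1 h₁, h₃.1.2, True.intro⟩, h₂, h₃.2⟩
      · rintro B _ _ ⟨⟨a, b, c⟩, x⟩ ⟨⟨h₁, h₄, -⟩, h₂, h₃⟩
        obtain rfl : a = 0 := h₁
        have h₄ : IsUnit b := h₄
        refine ⟨⟨?_, ?_⟩, h₂⟩
        · simp [h₂]
        · simp only [h₂, mul_zero, add_zero, zero_sub]
          exact (h₄.neg.mul h₄).mul h₃
      · rintro B _ _ ⟨⟨a, b, c⟩, x⟩ -
        simp
      · rintro B _ _ ⟨⟨a, b, c⟩, x⟩ -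
        simp

end PairClass

end PointFunctor

/-! ## The graph polynomials of rays and chains of rays -/

/-- Adding an edge `c` in series and then two edges `a`, `b` in parallel. -/
def nodeStep {B : Type*} [CommRing B] (a b c : B) (x : B × B) : B × B :=
  (a * b * x.1 + (a + b) * (x.2 + c * x.1), a * b * (x.2 + c * x.1))

/-- The spanning tree polynomial of a ray of a melonic star, and its spanning tree polynomial
after the identification of the two ends. -/
def rayPair {B : Type*} [CommRing B] : (n : ℕ) → (Fin n → Fin 4 → B) → B × B
  | 0, _ => (1, 0)
  | n + 1, t =>
    let x := nodeStep (t 0 0) (t 0 1) (t 0 2) (rayPair n (Fin.tail t))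
    (x.1, x.2 + t 0 3 * x.1)

/-- The same for a sequence of rays. -/
def chainPair {B : Type*} [CommRing B] {n : ℕ} : (s : ℕ) → (Fin s → Fin n → Fin 4 → B) → B × B
  | 0, _ => (1, 0)
  | s + 1, t =>
    ((rayPair n (t 0)).1 * (chainPair s (Fin.tail t)).1,
      (rayPair n (t 0)).2 * (chainPair s (Fin.tail t)).1 +
        (rayPair n (t 0)).1 * (chainPair s (Fin.tail t)).2)

/-! ### Classes of rays, chains and closed chains -/

namespace PointFunctor

variable {K : Type u} [Field K] {F G : PointFunctor K}

/-- Used to regroup coordinates: indexed families of edge variables are matched with the iterated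
products produced by the operations. -/
theorem PairClass.of_inverse {P Q : G.Fun} {p m : GrothendieckRing K}
    (h : PairClass G P Q p m) (f : F.Trans G) (hf : Natural f) (g : G.Trans F) (hg : Natural g)
    (hfg : ∀ (B : Type u) [CommRing B] [Algebra K B] (y : G.obj B), f B (g B y) = y)
    (hgf : ∀ (B : Type u) [CommRing B] [Algebra K B] (x : F.obj B), g B (f B x) = x) :
    PairClass F (fun B _ _ x => P B (f B x)) (fun B _ _ x => Q B (f B x)) p m := by
  have key : ∀ {Φ : G.Cond} {c : GrothendieckRing K}, G.HasClass Φ c →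
      F.HasClass (fun B _ _ x => Φ B (f B x)) c := by
    intro Φ c hc
    refine hc.of_bijOn g hg (fun B _ _ x hx => by rwa [hfg]) fun B _ _ y hy =>
      ⟨f B y, ⟨hy, hgf B y⟩, ?_⟩
    rintro x ⟨-, rfl⟩
    rw [hfg]
  exact ⟨fun B C _ _ _ _ φ x => by rw [hf, h.natP], fun B C _ _ _ _ φ x => by rw [hf, h.natQ],
    h.isAffine.imp fun c hc => key hc, key h.hasClass_isUnit, key h.hasClass_eq_zero⟩

/-- The classes attached to a ray of `n` nodes. -/
def rayClass (K : Type u) [Field K] : ℕ → GrothendieckRing K × GrothendieckRing K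
  | 0 => (1, 0)
  | n + 1 =>
    (lefschetz K * (torusClass K * lefschetz K ^ 2 * ((rayClass K n).1 + (rayClass K n).2)),
      lefschetz K * (torusClass K * ((torusClass K - 1) * (rayClass K n).1 +
        lefschetz K * (rayClass K n).2)))

theorem pairClass_ray (K : Type u) [Field K] (n : ℕ) :
    PairClass (((line K).pow (Fin 4)).pow (Fin n)) (fun B _ _ x => (rayPair (B := B) n x).1)
      (fun B _ _ x => (rayPair (B := B) n x).2) (rayClass K n).1 (rayClass K n).2 := by
  induction n with
  | zero =>
    exact PairClass.trivial.of_inverse (fun B _ _ _ => PUnit.unit) (fun B C _ _ _ _ φ x => rfl)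
      (fun B _ _ _ => Fin.elim0) (fun B C _ _ _ _ φ x => Subsingleton.elim _ _)
      (fun B _ _ _ => rfl) (fun B _ _ _ => Subsingleton.elim _ _)
  | succ n ih =>
    refine ih.node.series_edge.of_inverse (F := ((line K).pow (Fin 4)).pow (Fin (n + 1)))
      (fun B _ _ x => (x 0 3, ((x 0 0, x 0 1, x 0 2), Fin.tail x)))
      (fun B C _ _ _ _ φ x => rfl)
      (fun B _ _ y => Fin.cons (α := fun _ => Fin 4 → B)
        ![y.2.1.1, y.2.1.2.1, y.2.1.2.2, y.1] y.2.2)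
      (fun B C _ _ _ _ φ y => ?_) (fun B _ _ y => rfl) (fun B _ _ x => ?_)
    · funext i k
      refine Fin.cases ?_ (fun i => ?_) i
      · fin_cases k <;> rfl
      · rfl
    · funext i k
      refine Fin.cases ?_ (fun i => ?_) i
      · fin_cases k <;> rfl
      · rfl

/-- The factor `s` counts the ray whose `P` vanishes; the other `s - 1` rays have invertible `P`.
For `s = 0` this factor makes the truncated exponent harmless. -/
theorem pairClass_chain (K : Type u) [Field K] (s n : ℕ) :
    PairClass ((((line K).pow (Fin 4)).pow (Fin n)).pow (Fin s))
      (fun B _ _ x => (chainPair (B := B) s x).1) (fun B _ _ x => (chainPair (B := B) s x).2)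
      ((rayClass K n).1 ^ s) (s * (rayClass K n).2 * (rayClass K n).1 ^ (s - 1)) := by
  induction s with
  | zero =>
    simp only [pow_zero, Nat.cast_zero, zero_mul]
    exact PairClass.trivial.of_inverse (fun B _ _ _ => PUnit.unit) (fun B C _ _ _ _ φ x => rfl)
      (fun B _ _ _ => Fin.elim0) (fun B C _ _ _ _ φ x => Subsingleton.elim _ _)
      (fun B _ _ _ => rfl) (fun B _ _ _ => Subsingleton.elim _ _)
  | succ s ih =>
    have e : ((s + 1 : ℕ) : GrothendieckRing K) * (rayClass K n).2 * (rayClass K n).1 ^ (s + 1 - 1) =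
        (rayClass K n).1 * (s * (rayClass K n).2 * (rayClass K n).1 ^ (s - 1)) +
          (rayClass K n).2 * (rayClass K n).1 ^ s := by
      cases s with
      | zero => simp
      | succ s =>
        simp only [Nat.add_sub_cancel, pow_succ]
        push_cast
        ring
    rw [e, pow_succ']
    refine ((pairClass_ray K n).series ih).of_inverse
      (F := (((line K).pow (Fin 4)).pow (Fin n)).pow (Fin (s + 1))) (fun B _ _ x => (x 0, Fin.tail x))
      (fun B C _ _ _ _ φ x => rfl)
      (fun B _ _ y => Fin.cons (α := fun _ => Fin n → Fin 4 → B) y.1 y.2)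
      (fun B C _ _ _ _ φ y => ?_) (fun B _ _ y => rfl) (fun B _ _ x => ?_)
    · funext i
      exact Fin.cases rfl (fun i => rfl) i
    · exact Fin.cons_self_tail x

/-- A `PairClass` controls `Q` only where `P = 0`. To treat the whole locus `Q ≠ 0`, the edge `(0,
0, 3)` of the central oval is set aside and added last by `hasClass_series_edge`, to the first ray
without this edge in series with the other rays. -/
theorem hasClass_closed_chain (K : Type u) [Field K] (s n : ℕ) :
    ((((line K).pow (Fin 4)).pow (Fin (n + 1))).pow (Fin (s + 1))).HasClass
      (fun B _ _ x => IsUnit (chainPair (B := B) (s + 1) x).2)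
      (torusClass K * (torusClass K * lefschetz K ^ 2 * ((rayClass K n).1 + (rayClass K n).2) *
          (rayClass K (n + 1)).1 ^ s) +
        lefschetz K * (torusClass K * lefschetz K ^ 2 * ((rayClass K n).1 + (rayClass K n).2) *
            (s * (rayClass K (n + 1)).2 * (rayClass K (n + 1)).1 ^ (s - 1)) +
          torusClass K * ((torusClass K - 1) * (rayClass K n).1 +
            lefschetz K * (rayClass K n).2) * (rayClass K (n + 1)).1 ^ s)) := by
  refine ((pairClass_ray K n).node.series (pairClass_chain K s (n + 1))).hasClass_series_edge.of_bijOn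
    (fun B _ _ y => Fin.cons (α := fun _ => Fin (n + 1) → Fin 4 → B)
      (Fin.cons (α := fun _ => Fin 4 → B)
        ![y.2.1.1.1, y.2.1.1.2.1, y.2.1.1.2.2, y.1] y.2.1.2) y.2.2)
    (fun B C _ _ _ _ φ y => ?_) (fun B _ _ y hy => ?_) (fun B _ _ x hx => ?_)
  · funext i j k
    refine Fin.cases ?_ (fun i => rfl) i
    refine Fin.cases ?_ (fun j => rfl) j
    fin_cases k <;> rfl
  · convert hy using 1
    simp only [chainPair, rayPair, nodeStep, Fin.cons_zero, Fin.tail_cons]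
    simp
    ring
  · refine ⟨(x 0 0 3, (((x 0 0 0, x 0 0 1, x 0 0 2), Fin.tail (x 0)), Fin.tail x)),
      ⟨?_, ?_⟩, ?_⟩
    · convert hx using 1
      simp only [chainPair, rayPair, nodeStep]
      ring
    · funext i j k
      refine Fin.cases ?_ (fun i => rfl) i
      refine Fin.cases ?_ (fun j => rfl) j
      fin_cases k <;> rfl
    · rintro ⟨d, ⟨⟨a, b, c⟩, x⟩, y⟩ ⟨-, rfl⟩
      rfl

end PointFunctor

/-! ## The polynomials `A_n` and `σ^s_n` -/

/-- A pair of sequences of polynomials; the first one is `A_n`, see `polyA_eq`. -/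
def rayPoly : ℕ → Polynomial ℤ × Polynomial ℤ
  | 0 => (1, 0)
  | n + 1 => ((Polynomial.X + 1) * (rayPoly n).1 + (rayPoly n).2,
      (Polynomial.X - 1) * (rayPoly n).1 + (rayPoly n).2)

-- The even part of the binomial expansion of `(r + ω) ^ k` with `ω ^ 2 = u`; odd powers of `ω` have
-- no real part.
open QuadraticAlgebra in
theorem re_pow_quadraticAlgebra {R : Type*} [CommRing R] (r u : R) (k : ℕ) :
    ((⟨r, 1⟩ : QuadraticAlgebra R u 0) ^ k).re =
      ∑ l ∈ Finset.range (k / 2 + 1), (k.choose (2 * l) : R) * r ^ (k - 2 * l) * u ^ l := by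
  have h2 : ∀ l : ℕ, (⟨0, 1⟩ : QuadraticAlgebra R u 0) ^ (2 * l) = ⟨u ^ l, 0⟩ := by
    intro l
    induction l with
    | zero => simp [QuadraticAlgebra.ext_iff]
    | succ l ih =>
      rw [mul_add, pow_add, ih]
      ext <;> simp [pow_succ]
  have h3 : ∀ m : ℕ, (⟨r, 0⟩ : QuadraticAlgebra R u 0) ^ m = ⟨r ^ m, 0⟩ := fun m =>
    (C_pow (a := u) (b := 0) m r).symm
  have h1 : (⟨r, 1⟩ : QuadraticAlgebra R u 0) = ⟨0, 1⟩ + ⟨r, 0⟩ := by ext <;> simp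
  rw [h1, add_pow]
  change reₗ u 0 _ = _
  rw [map_sum]
  have hinj : Set.InjOn (fun l : ℕ => 2 * l) (Finset.range (k / 2 + 1) : Set ℕ) := by
    intro a _ b _ h
    simpa using h
  have himg : ((Finset.range (k / 2 + 1)).image fun l => 2 * l) ⊆ Finset.range (k + 1) := by
    intro m hm
    simp only [Finset.mem_image, Finset.mem_range] at hm ⊢
    omega
  rw [← Finset.sum_subset himg, Finset.sum_image hinj]
  · refine Finset.sum_congr rfl fun l _ => ?_
    change ((⟨0, 1⟩ : QuadraticAlgebra R u 0) ^ (2 * l) * ⟨r, 0⟩ ^ (k - 2 * l) *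
      (k.choose (2 * l) : QuadraticAlgebra R u 0)).re = _
    rw [h2, h3]
    simp
    ring
  · intro m hm hm'
    obtain ⟨l, rfl⟩ : ∃ l, m = 2 * l + 1 := by
      refine (Nat.even_or_odd' m).elim fun l hl => hl.elim (fun h => ?_) fun h => ⟨l, h⟩
      refine absurd ?_ hm'
      simp only [Finset.mem_image, Finset.mem_range] at *
      exact ⟨l, by omega, by omega⟩
    change ((⟨0, 1⟩ : QuadraticAlgebra R u 0) ^ (2 * l + 1) * ⟨r, 0⟩ ^ (k - (2 * l + 1)) *
      (k.choose (2 * l + 1) : QuadraticAlgebra R u 0)).re = _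
    rw [pow_succ, h2, h3]
    simp

/-- Algebraically, `e^{rx} cos(τx)` is the real part of `e^{(r + iτ)x}`, with `ω = iτ` and `ω ^ 2 =
r t - r ^ 2`. -/
theorem expCosPoly_eq_re (k : ℕ) :
    expCosPoly k = ((⟨Polynomial.X, 1⟩ : QuadraticAlgebra (Polynomial (Polynomial ℤ))
      (Polynomial.X * Polynomial.C Polynomial.X - Polynomial.X ^ 2) 0) ^ k).re := by
  rw [re_pow_quadraticAlgebra, expCosPoly]
  refine Finset.sum_congr rfl fun l _ => ?_
  have : (Polynomial.X * Polynomial.C Polynomial.X - Polynomial.X ^ 2 :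
      Polynomial (Polynomial ℤ)) =
        -1 * (Polynomial.X ^ 2 - Polynomial.X * Polynomial.C Polynomial.X) := by ring
  rw [this, mul_pow]
  ring

theorem expCosPoly_zero : expCosPoly 0 = 1 := by simp [expCosPoly]

theorem expCosPoly_one : expCosPoly 1 = Polynomial.X := by simp [expCosPoly]

/-- The characteristic equation of `r + ω`, which has trace `2 r` and norm `2 r ^ 2 - r t`. -/
theorem expCosPoly_add_two (k : ℕ) :
    expCosPoly (k + 2) = Polynomial.X * (2 * expCosPoly (k + 1) +
      (Polynomial.C Polynomial.X - 2 * Polynomial.X) * expCosPoly k) := by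
  simp only [expCosPoly_eq_re, pow_succ]
  generalize (⟨Polynomial.X, 1⟩ : QuadraticAlgebra (Polynomial (Polynomial ℤ))
    (Polynomial.X * Polynomial.C Polynomial.X - Polynomial.X ^ 2) 0) ^ k = z
  simp only [QuadraticAlgebra.re_mul, QuadraticAlgebra.im_mul]
  ring

theorem polyA_eq_sum (n N : ℕ) (h : 2 * n + 1 ≤ N) :
    polyA n = ∑ k ∈ Finset.range N, (expCosPoly k).coeff n := by
  refine Finset.sum_subset (Finset.range_mono h) fun k _ hk => ?_
  exact coeff_expCosPoly_of_lt (by simpa using hk)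

theorem polyA_zero : polyA 0 = 1 := by
  simp [polyA, expCosPoly_zero]

theorem polyA_one : polyA 1 = Polynomial.X + 1 := by
  simp [polyA, Finset.sum_range_succ, expCosPoly_zero, expCosPoly_one, expCosPoly_add_two,
    Polynomial.coeff_one, Polynomial.coeff_X]
  ring

/-- Obtained by summing over `k` the coefficients of `r ^ (n + 2)` in `expCosPoly_add_two`;
`expCosPoly 0` and `expCosPoly 1` do not reach this degree. -/
theorem polyA_add_two (n : ℕ) :
    polyA (n + 2) = (2 + Polynomial.X) * polyA (n + 1) - 2 * polyA n := by
  rw [polyA_eq_sum (n + 2) (2 * n + 7) (by omega), Finset.sum_range_succ', Finset.sum_range_succ',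
    expCosPoly_zero, expCosPoly_one]
  have h1 : polyA (n + 1) = ∑ k ∈ Finset.range (2 * n + 5), (expCosPoly (k + 1)).coeff (n + 1) := by
    rw [polyA_eq_sum (n + 1) (2 * n + 6) (by omega), Finset.sum_range_succ', expCosPoly_zero]
    simp [Polynomial.coeff_one]
  have h2 : ∀ k, (expCosPoly (k + 1 + 1)).coeff (n + 2) = 2 * (expCosPoly (k + 1)).coeff (n + 1) +
      Polynomial.X * (expCosPoly k).coeff (n + 1) - 2 * (expCosPoly k).coeff n := by
    intro k
    rw [expCosPoly_add_two, Polynomial.coeff_X_mul, Polynomial.coeff_add, sub_mul,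
      Polynomial.coeff_sub, Polynomial.coeff_C_mul, Polynomial.coeff_ofNat_mul, mul_assoc,
      Polynomial.coeff_ofNat_mul, Polynomial.coeff_X_mul]
    ring
  simp only [h2, Finset.sum_add_distrib, Finset.sum_sub_distrib, ← Finset.mul_sum]
  rw [← h1, ← polyA_eq_sum (n + 1) (2 * n + 5) (by omega),
    ← polyA_eq_sum n (2 * n + 5) (by omega)]
  simp [Polynomial.coeff_one, Polynomial.coeff_X]
  ring

/-- By Cayley–Hamilton for the matrix of `rayPoly`, with trace `2 + t` and determinant `2`, both
sides satisfy `polyA_add_two`. -/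
theorem polyA_eq (n : ℕ) : polyA n = (rayPoly n).1 := by
  induction n using Nat.strong_induction_on with
  | _ n ih =>
    match n with
    | 0 => exact polyA_zero
    | 1 => rw [polyA_one]; simp [rayPoly]
    | n + 2 =>
      rw [polyA_add_two, ih (n + 1) (by omega), ih n (by omega)]
      simp only [rayPoly]
      ring

theorem coeff_starDen_mul (W : PowerSeries (Polynomial ℤ)) (m : ℕ) :
    PowerSeries.coeff (m + 2) (starDen * W) = PowerSeries.coeff (m + 2) W -
      (2 + Polynomial.X) * PowerSeries.coeff (m + 1) W + 2 * PowerSeries.coeff m W := by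
  have h : starDen * W = W - PowerSeries.C (2 + Polynomial.X) * (PowerSeries.X * W) +
      PowerSeries.C 2 * (PowerSeries.X * (PowerSeries.X * W)) := by
    rw [starDen, map_ofNat]
    ring
  rw [h, map_add, map_sub, PowerSeries.coeff_C_mul, PowerSeries.coeff_C_mul,
    PowerSeries.coeff_succ_X_mul, PowerSeries.coeff_succ_X_mul, PowerSeries.coeff_succ_X_mul]

theorem coeff_starNum (s m : ℕ) : PowerSeries.coeff m (starNum s) =
    if m = 0 then 1 else if m = 1 then -2 else if m = 2 then
      ((s : Polynomial ℤ) - 1) * Polynomial.X - ((s : Polynomial ℤ) - 2) else 0 := by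
  have h : starNum s = 1 - PowerSeries.C 2 * PowerSeries.X +
      PowerSeries.C (((s : Polynomial ℤ) - 1) * Polynomial.X - ((s : Polynomial ℤ) - 2)) *
        PowerSeries.X ^ 2 := by
    rw [starNum, map_ofNat]
  rw [h, map_add, map_sub, PowerSeries.coeff_C_mul, PowerSeries.coeff_C_mul,
    PowerSeries.coeff_one, PowerSeries.coeff_X, PowerSeries.coeff_X_pow]
  rcases m with _ | _ | _ | m <;> simp

theorem coeff_one_add_X_mul_mk (f : ℕ → Polynomial ℤ) (m : ℕ) :
    PowerSeries.coeff (m + 1) (1 + PowerSeries.X * PowerSeries.mk f) = f m := by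
  simp [PowerSeries.coeff_succ_X_mul, PowerSeries.coeff_one]

theorem polySigma_zero (s : ℕ) : polySigma s 0 = Polynomial.X := by
  have h := congrArg (PowerSeries.coeff 1) (polySigma_expansion s)
  have h2 : starDen * (1 + PowerSeries.X * PowerSeries.mk fun n => polySigma s n) =
      (1 + PowerSeries.X * PowerSeries.mk fun n => polySigma s n) + PowerSeries.X *
        ((PowerSeries.C (-(2 + Polynomial.X)) + PowerSeries.C 2 * PowerSeries.X) *
          (1 + PowerSeries.X * PowerSeries.mk fun n => polySigma s n)) := by
    rw [starDen, map_ofNat, map_neg]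
    ring
  rw [h2, coeff_starNum, map_add, coeff_one_add_X_mul_mk, PowerSeries.coeff_succ_X_mul] at h
  simp at h
  linear_combination -h

/-- The denominator `starDen` encodes the same recurrence, so only the initial values depend on the
numerator. -/
theorem polySigma_eq (s n : ℕ) :
    polySigma s n = Polynomial.X * (rayPoly n).1 + (s : Polynomial ℤ) * (rayPoly n).2 := by
  have h : ∀ m, _ := fun m => congrArg (PowerSeries.coeff (m + 2)) (polySigma_expansion s)
  simp only [coeff_starDen_mul, coeff_starNum, coeff_one_add_X_mul_mk] at h
  induction n using Nat.strong_induction_on with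
  | _ n ih =>
    match n with
    | 0 => simp [polySigma_zero, rayPoly]
    -- The coefficient of `r ^ 2` is the one in which the `s`-dependent term of the numerator
    -- appears.
    | 1 =>
      have h0 := h 0
      simp [polySigma_zero] at h0
      simp [rayPoly]
      linear_combination -h0
    | n + 2 =>
      have h1 := h (n + 1)
      rw [coeff_one_add_X_mul_mk, ih (n + 1) (by omega), ih n (by omega)] at h1
      simp [rayPoly] at h1 ⊢
      linear_combination -h1

/-! ## Spanning trees as minimal connected sets -/

namespace Multigraph

variable {V E : Type}

/-- Every colouring of the vertices that is constant along the edges of `T` is constant. -/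
def Connects (G : Multigraph V E) (T : Finset E) : Prop :=
  ∀ f : V → Bool, (∀ e ∈ T, ∀ u v, G.ends e = s(u, v) → f u = f v) → ∀ u v, f u = f v

theorem Connects.mono {G : Multigraph V E} {S T : Finset E} (h : G.Connects S)
    (hST : ∀ e ∈ S, ∀ f : V → Bool, (∀ e ∈ T, ∀ u v, G.ends e = s(u, v) → f u = f v) →
      ∀ u v, G.ends e = s(u, v) → f u = f v) : G.Connects T :=
  fun f hf => h f fun e he u v huv => hST e he f hf u v huv

/-- The set of vertices reachable from a given one is itself a 2-colouring; conversely a colouring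
is constant along walks. -/
theorem connects_iff_preconnected (G : Multigraph V E) (T : Finset E) :
    G.Connects T ↔ (SimpleGraph.fromEdgeSet (G.ends '' (T : Set E))).Preconnected := by
  classical
  constructor
  · intro h u v
    have := h (fun w => decide ((SimpleGraph.fromEdgeSet (G.ends '' (T : Set E))).Reachable u w))
      (fun e he x y hxy => ?_) u v
    · simpa using this
    · rw [decide_eq_decide]
      by_cases hne : x = y
      · rw [hne]
      · have hadj : (SimpleGraph.fromEdgeSet (G.ends '' (T : Set E))).Adj x y :=
          (SimpleGraph.fromEdgeSet_adj _).2 ⟨⟨e, he, hxy⟩, hne⟩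
        exact ⟨fun h => h.trans hadj.reachable, fun h => h.trans hadj.symm.reachable⟩
  · intro h f hf u v
    obtain ⟨w⟩ := h u v
    induction w with
    | nil => rfl
    | cons hadj _ ih =>
      obtain ⟨⟨e, he, hxy⟩, -⟩ := (SimpleGraph.fromEdgeSet_adj _).1 hadj
      exact (hf e he _ _ hxy).trans ih

/-- Every edge of a tree is a bridge, so none can be dropped. Conversely, minimality excludes loops,
parallel edges and non-bridges. -/
theorem isSpanningTree_iff_minimal [Nonempty V] (G : Multigraph V E) (T : Finset E) :
    G.IsSpanningTree T ↔ Minimal G.Connects T := by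
  classical
  constructor
  · rintro ⟨hloop, hinj, htree⟩
    refine ⟨(G.connects_iff_preconnected T).2 htree.connected.preconnected, fun S hS hST e he => ?_⟩
    by_contra heS
    obtain ⟨x, y, hxy⟩ : ∃ x y, G.ends e = s(x, y) := by
      induction h : G.ends e with | _ x y => exact ⟨x, y, rfl⟩
    rw [connects_iff_preconnected] at hS
    have hne : x ≠ y := by
      rintro rfl
      exact hloop e he (hxy ▸ Sym2.mk_isDiag_iff.2 rfl)
    have hadj : (SimpleGraph.fromEdgeSet (G.ends '' (T : Set E))).Adj x y :=
      (SimpleGraph.fromEdgeSet_adj _).2 ⟨⟨e, he, hxy⟩, hne⟩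
    have hb := SimpleGraph.isAcyclic_iff_forall_isBridge.1 htree.isAcyclic
      (SimpleGraph.mem_edgeSet _ |>.2 hadj)
    rw [SimpleGraph.isBridge_iff] at hb
    refine hb ((hS x y).mono ?_)
    intro p q hpq
    obtain ⟨⟨e', he', hpq'⟩, hne'⟩ := (SimpleGraph.fromEdgeSet_adj _).1 hpq
    rw [SimpleGraph.deleteEdges_adj]
    refine ⟨(SimpleGraph.fromEdgeSet_adj _).2 ⟨⟨e', hST he', hpq'⟩, hne'⟩, ?_⟩
    rw [Set.mem_singleton_iff, ← hpq', ← hxy]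
    intro h
    exact heS (hinj (hST he') he h ▸ he')
  · intro h
    -- Minimality in terms of colourings: without `e`, some colouring compatible with the other
    -- edges separates the ends of `e`.
    have hdel : ∀ e ∈ T, ∀ u v, G.ends e = s(u, v) → ∃ f : V → Bool,
        (∀ e' ∈ T, e' ≠ e → ∀ u v, G.ends e' = s(u, v) → f u = f v) ∧ f u ≠ f v := by
      intro e he u v huv
      by_contra! hcon
      refine (h.not_prop_of_lt (Finset.erase_ssubset he)) (h.prop.mono fun e' he' f hf x y hxy => ?_)
      have hf' : ∀ e' ∈ T, e' ≠ e → ∀ u v, G.ends e' = s(u, v) → f u = f v :=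
        fun e' he' hne => hf e' (Finset.mem_erase.2 ⟨hne, he'⟩)
      by_cases hee : e' = e
      · subst hee
        rw [huv, Sym2.eq_iff] at hxy
        rcases hxy with ⟨rfl, rfl⟩ | ⟨rfl, rfl⟩
        · exact hcon f hf'
        · exact (hcon f hf').symm
      · exact hf' e' he' hee x y hxy
    refine ⟨fun e he => ?_, fun e he e' he' hee => ?_, ?_⟩
    · induction hxy : G.ends e with | _ x y =>
      rintro (rfl : x = y)
      obtain ⟨f, -, hf⟩ := hdel e he x x hxy
      exact hf rfl
    · by_contra hne
      induction hxy : G.ends e with | _ x y =>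
      obtain ⟨f, hf, hf'⟩ := hdel e he x y hxy
      exact hf' (hf e' he' (Ne.symm hne) x y (hee ▸ hxy))
    · have hpre := (G.connects_iff_preconnected T).1 h.prop
      refine ⟨⟨hpre⟩, ?_⟩
      rw [SimpleGraph.isAcyclic_iff_forall_isBridge]
      intro a ha
      induction a with | _ x y
      obtain ⟨⟨e, he, hxy⟩, -⟩ := (SimpleGraph.fromEdgeSet_adj _).1 ((SimpleGraph.mem_edgeSet _).1 ha)
      rw [SimpleGraph.isBridge_iff]
      rintro ⟨w⟩
      obtain ⟨f, hf, hf'⟩ := hdel e he x y hxy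
      refine hf' ?_
      clear hf' ha
      generalize hd : SimpleGraph.deleteEdges _ _ = H at w
      have key : ∀ p q, H.Adj p q → f p = f q := by
        intro p q hpq
        rw [← hd, SimpleGraph.deleteEdges_adj, Set.mem_singleton_iff] at hpq
        obtain ⟨⟨e', he', hpq'⟩, -⟩ := (SimpleGraph.fromEdgeSet_adj _).1 hpq.1
        refine hf e' he' ?_ p q hpq'
        rintro rfl
        exact hpq.2 (hpq'.symm.trans hxy)
      clear hxy hd
      induction w with
      | nil => rfl
      | cons hadj _ ih => exact (key _ _ hadj).trans ih

end Multigraph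

/-! ## Networks with two terminals -/

/-- A network with two terminals, as far as its spanning trees are concerned: `Ω` is the ordered
set of its sets of edges, `joined T` says that `T` joins all vertices, and `split T` says that `T`
does so after the identification of the two terminals. -/
structure Network (Ω : Type*) [PartialOrder Ω] where
  joined : Ω → Prop
  split : Ω → Prop
  not_joined : ∀ ⦃S T⦄, Minimal split T → S ≤ T → ¬ joined S

namespace Network

section

variable {Ω₁ Ω₂ : Type*} [PartialOrder Ω₁] [PartialOrder Ω₂]

theorem minimal_and_iff {p : Ω₁ → Prop} {q : Ω₂ → Prop} {T : Ω₁ × Ω₂} :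
    Minimal (fun T : Ω₁ × Ω₂ => p T.1 ∧ q T.2) T ↔ Minimal p T.1 ∧ Minimal q T.2 := by
  constructor
  · rintro ⟨⟨h₁, h₂⟩, h⟩
    exact ⟨⟨h₁, fun S hS hST => (h (y := (S, T.2)) ⟨hS, h₂⟩ ⟨hST, le_rfl⟩).1⟩,
      ⟨h₂, fun S hS hST => (h (y := (T.1, S)) ⟨h₁, hS⟩ ⟨le_rfl, hST⟩).2⟩⟩
  · rintro ⟨h₁, h₂⟩
    exact ⟨⟨h₁.1, h₂.1⟩, fun S hS hST => ⟨h₁.2 hS.1 hST.1, h₂.2 hS.2 hST.2⟩⟩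

variable (M₁ : Network Ω₁) (M₂ : Network Ω₂)

/-- Exactly one of the two networks is allowed to be split. -/
def OneSplit (T : Ω₁ × Ω₂) : Prop :=
  (M₁.split T.1 ∧ M₂.joined T.2) ∨ (M₁.joined T.1 ∧ M₂.split T.2)

/-- The field `not_joined` keeps the two alternatives from interfering: nothing below a minimal
element of one kind is of the other kind. -/
theorem minimal_oneSplit_iff {T : Ω₁ × Ω₂} : Minimal (OneSplit M₁ M₂) T ↔
    (Minimal M₁.split T.1 ∧ Minimal M₂.joined T.2) ∨
      (Minimal M₁.joined T.1 ∧ Minimal M₂.split T.2) := by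
  constructor
  · intro h
    exact h.or.imp minimal_and_iff.1 minimal_and_iff.1
  · rintro (⟨h₁, h₂⟩ | ⟨h₁, h₂⟩)
    · refine ⟨Or.inl ⟨h₁.1, h₂.1⟩, ?_⟩
      rintro S (hS | hS) hST
      · exact ⟨h₁.2 hS.1 hST.1, h₂.2 hS.2 hST.2⟩
      · exact absurd hS.1 (M₁.not_joined h₁ hST.1)
    · refine ⟨Or.inr ⟨h₁.1, h₂.1⟩, ?_⟩
      rintro S (hS | hS) hST
      · exact absurd hS.2 (M₂.not_joined h₂ hST.2)
      · exact ⟨h₁.2 hS.1 hST.1, h₂.2 hS.2 hST.2⟩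

/-- Two networks in series. -/
def series : Network (Ω₁ × Ω₂) where
  joined T := M₁.joined T.1 ∧ M₂.joined T.2
  split := OneSplit M₁ M₂
  not_joined := by
    intro S T hT hST hS
    rcases (minimal_oneSplit_iff M₁ M₂).1 hT with h | h
    · exact M₁.not_joined h.1 hST.1 hS.1
    · exact M₂.not_joined h.2 hST.2 hS.2

/-- Two networks in parallel. -/
def parallel : Network (Ω₁ × Ω₂) where
  joined := OneSplit M₁ M₂
  split T := M₁.split T.1 ∧ M₂.split T.2
  not_joined := by
    intro S T hT hST hS
    have h := minimal_and_iff.1 hT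
    rcases hS with hS | hS
    · exact M₂.not_joined h.2 hST.2 hS.2
    · exact M₁.not_joined h.1 hST.1 hS.1

/-- The network consisting of one edge. -/
def edge : Network Bool where
  joined T := T = true
  split _ := True
  not_joined := by
    rintro S T ⟨-, hT⟩ hST rfl
    have : T ≤ false := hT trivial (Bool.false_le T)
    exact absurd (hST.trans this) (by decide)

/-- The network without edges whose two terminals coincide. -/
def point (Ω : Type*) [PartialOrder Ω] : Network Ω where
  joined _ := True
  split _ := False
  not_joined _ _ hT := absurd hT.prop id

theorem minimal_comp_iff (e : Ω₁ ≃o Ω₂) {p : Ω₂ → Prop} {T : Ω₁} :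
    Minimal (fun T => p (e T)) T ↔ Minimal p (e T) := by
  constructor
  · rintro ⟨h, h'⟩
    refine ⟨h, fun S hS hST => ?_⟩
    have := h' (y := e.symm S) (by simpa using hS) (by simpa [OrderIso.symm_apply_le] using hST)
    simpa [OrderIso.le_symm_apply] using this
  · rintro ⟨h, h'⟩
    exact ⟨h, fun S hS hST => e.le_iff_le.1 (h' hS (e.monotone hST))⟩

variable {M₁ M₂}

/-- Transport of a network along an isomorphism. -/
def comap (e : Ω₁ ≃o Ω₂) (M : Network Ω₂) : Network Ω₁ where
  joined T := M.joined (e T)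
  split T := M.split (e T)
  not_joined _ _ hT hST := M.not_joined ((minimal_comp_iff e).1 hT) (e.monotone hST)

end

/-! ### Generating functions of minimal sets of edges -/

open Classical in
/-- The sum of the weights of the minimal elements with a given property. -/
def gen {Ω B : Type*} [PartialOrder Ω] [Fintype Ω] [CommRing B] (w : Ω → B) (p : Ω → Prop) : B :=
  ∑ T, if Minimal p T then w T else 0

section gen

variable {Ω Ω₁ Ω₂ B : Type*} [PartialOrder Ω] [PartialOrder Ω₁] [PartialOrder Ω₂] [Fintype Ω]
  [Fintype Ω₁] [Fintype Ω₂] [CommRing B]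

/-- The product of two weights. -/
def mulWeight (w₁ : Ω₁ → B) (w₂ : Ω₂ → B) (T : Ω₁ × Ω₂) : B := w₁ T.1 * w₂ T.2

theorem gen_and (w₁ : Ω₁ → B) (w₂ : Ω₂ → B) (p : Ω₁ → Prop) (q : Ω₂ → Prop) :
    gen (mulWeight w₁ w₂) (fun T => p T.1 ∧ q T.2) = gen w₁ p * gen w₂ q := by
  classical
  rw [gen, gen, gen, Finset.sum_mul_sum, Fintype.sum_prod_type]
  refine Finset.sum_congr rfl fun T₁ _ => Finset.sum_congr rfl fun T₂ _ => ?_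
  rw [ite_zero_mul_ite_zero]
  exact if_congr minimal_and_iff rfl rfl

/-- The sum has no correction term because a minimal split set is never joined. -/
theorem gen_oneSplit (w₁ : Ω₁ → B) (w₂ : Ω₂ → B) (M₁ : Network Ω₁) (M₂ : Network Ω₂) :
    gen (mulWeight w₁ w₂) (OneSplit M₁ M₂) =
      gen w₁ M₁.split * gen w₂ M₂.joined + gen w₁ M₁.joined * gen w₂ M₂.split := by
  classical
  rw [← gen_and, ← gen_and, gen, gen, gen, ← Finset.sum_add_distrib]
  refine Finset.sum_congr rfl fun T _ => ?_
  simp only [minimal_oneSplit_iff, minimal_and_iff]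
  by_cases h₁ : Minimal M₁.split T.1 ∧ Minimal M₂.joined T.2
  · have h₂ : ¬ (Minimal M₁.joined T.1 ∧ Minimal M₂.split T.2) := fun h =>
      M₁.not_joined h₁.1 le_rfl h.1.prop
    simp [h₁, h₂]
  · simp [h₁]

theorem gen_comp (e : Ω₁ ≃o Ω₂) {w₁ : Ω₁ → B} {w₂ : Ω₂ → B} (hw : ∀ T, w₁ T = w₂ (e T))
    (p : Ω₂ → Prop) : gen w₁ (fun T => p (e T)) = gen w₂ p := by
  classical
  rw [gen, gen]
  exact Fintype.sum_equiv e.toEquiv _ _ fun T => if_congr (minimal_comp_iff e) (hw T) rfl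

/-- The generating functions of a network. -/
def genPair (w : Ω → B) (M : Network Ω) : B × B := (gen w M.joined, gen w M.split)

theorem genPair_series (w₁ : Ω₁ → B) (w₂ : Ω₂ → B) (M₁ : Network Ω₁) (M₂ : Network Ω₂) :
    genPair (mulWeight w₁ w₂) (M₁.series M₂) =
      ((genPair w₁ M₁).1 * (genPair w₂ M₂).1,
        (genPair w₁ M₁).2 * (genPair w₂ M₂).1 + (genPair w₁ M₁).1 * (genPair w₂ M₂).2) :=
  Prod.ext (gen_and w₁ w₂ _ _) (gen_oneSplit w₁ w₂ M₁ M₂)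

theorem genPair_parallel (w₁ : Ω₁ → B) (w₂ : Ω₂ → B) (M₁ : Network Ω₁) (M₂ : Network Ω₂) :
    genPair (mulWeight w₁ w₂) (M₁.parallel M₂) =
      ((genPair w₁ M₁).2 * (genPair w₂ M₂).1 + (genPair w₁ M₁).1 * (genPair w₂ M₂).2,
        (genPair w₁ M₁).2 * (genPair w₂ M₂).2) :=
  Prod.ext (gen_oneSplit w₁ w₂ M₁ M₂) (gen_and w₁ w₂ _ _)

theorem genPair_comap (e : Ω₁ ≃o Ω₂) {w₁ : Ω₁ → B} (w₂ : Ω₂ → B) (hw : ∀ T, w₁ T = w₂ (e T))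
    (M : Network Ω₂) : genPair w₁ (M.comap e) = genPair w₂ M :=
  Prod.ext (gen_comp e hw _) (gen_comp e hw _)

theorem genPair_point [Unique Ω] (w : Ω → B) : genPair w (point Ω) = (w default, 0) := by
  have h : IsMin (default : Ω) := fun T _ => (Subsingleton.elim _ _).le
  simp [genPair, gen, point, h]

/-- The weight of an edge with variable `t`. -/
def edgeWeight (t : B) (T : Bool) : B := if T then 1 else t

theorem genPair_edge (t : B) : genPair (edgeWeight t) edge = (1, t) := by
  have h₁ : Minimal (fun T : Bool => T = true) true := ⟨rfl, by rintro _ rfl _; exact le_rfl⟩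
  have h₂ : ¬ Minimal (fun T : Bool => T = true) false := fun h => absurd h.prop (by decide)
  have h₃ : ¬ IsMin true := fun h => absurd (h (Bool.false_le true)) (by decide)
  have h₄ : IsMin false := fun T _ => Bool.false_le T
  simp [genPair, gen, edge, edgeWeight]

end gen

/-- The edges of the first node of a ray and the remaining nodes. -/
def rayEquiv (n : ℕ) :
    (Fin (n + 1) → Fin 4 → Bool) ≃o (Bool × (Bool × (Bool × (Fin n → Fin 4 → Bool)))) × Bool where
  toFun T := ((T 0 0, T 0 1, T 0 2, Fin.tail T), T 0 3)
  invFun T := Fin.cons (α := fun _ => Fin 4 → Bool) ![T.1.1, T.1.2.1, T.1.2.2.1, T.2] T.1.2.2.2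
  left_inv T := by
    funext i k
    refine Fin.cases ?_ (fun i => rfl) i
    fin_cases k <;> rfl
  right_inv T := rfl
  map_rel_iff' := by
    intro S T
    change (((S 0 0 ≤ T 0 0 ∧ S 0 1 ≤ T 0 1 ∧ S 0 2 ≤ T 0 2 ∧ Fin.tail S ≤ Fin.tail T) ∧
      S 0 3 ≤ T 0 3) ↔ _)
    rw [Pi.le_def (x := S), Fin.forall_fin_succ (n := n), Pi.le_def (x := S 0),
      Fin.forall_fin_succ (n := 3), Fin.forall_fin_succ (n := 2), Fin.forall_fin_succ (n := 1),
      Fin.forall_fin_one]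
    exact ⟨fun h => ⟨⟨h.1.1, h.1.2.1, h.1.2.2.1, h.2⟩, h.1.2.2.2⟩,
      fun h => ⟨⟨h.1.1, h.1.2.1, h.1.2.2.1, h.2⟩, h.1.2.2.2⟩⟩

/-- The first ray and the remaining ones. -/
def chainEquiv (s n : ℕ) :
    (Fin (s + 1) → Fin n → Fin 4 → Bool) ≃o
      (Fin n → Fin 4 → Bool) × (Fin s → Fin n → Fin 4 → Bool) where
  toFun T := (T 0, Fin.tail T)
  invFun T := Fin.cons (α := fun _ => Fin n → Fin 4 → Bool) T.1 T.2
  left_inv T := Fin.cons_self_tail T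
  right_inv T := rfl
  map_rel_iff' := by
    intro S T
    change (S 0 ≤ T 0 ∧ Fin.tail S ≤ Fin.tail T ↔ _)
    rw [Pi.le_def (x := S), Fin.forall_fin_succ (n := s)]
    rfl

/-- The network of a ray. -/
def ray : (n : ℕ) → Network (Fin n → Fin 4 → Bool)
  | 0 => point _
  | n + 1 => ((edge.parallel (edge.parallel (edge.series (ray n)))).series edge).comap (rayEquiv n)

/-- The network of a sequence of rays. -/
def chain (n : ℕ) : (s : ℕ) → Network (Fin s → Fin n → Fin 4 → Bool)
  | 0 => point _
  | s + 1 => ((ray n).series (chain n s)).comap (chainEquiv s n)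

variable {B : Type*} [CommRing B]

theorem genPair_ray (n : ℕ) (t : Fin n → Fin 4 → B) :
    genPair (fun T => ∏ j, ∏ k, edgeWeight (t j k) (T j k)) (ray n) = rayPair n t := by
  induction n with
  | zero => exact (genPair_point _).trans (by simp [rayPair])
  | succ n ih =>
    rw [ray, genPair_comap (rayEquiv n) (mulWeight (mulWeight (edgeWeight (t 0 0))
      (mulWeight (edgeWeight (t 0 1)) (mulWeight (edgeWeight (t 0 2))
        fun T => ∏ j, ∏ k, edgeWeight (Fin.tail t j k) (T j k)))) (edgeWeight (t 0 3))),
      genPair_series, genPair_parallel, genPair_parallel, genPair_series,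
      ih, genPair_edge, genPair_edge, genPair_edge, genPair_edge, rayPair, nodeStep]
    · ext <;> simp <;> ring
    · intro T
      rw [Fin.prod_univ_succ, Fin.prod_univ_four]
      change _ = (edgeWeight (t 0 0) (T 0 0) * (edgeWeight (t 0 1) (T 0 1) *
        (edgeWeight (t 0 2) (T 0 2) * ∏ j : Fin n, ∏ k, edgeWeight (t j.succ k) (T j.succ k)))) *
          edgeWeight (t 0 3) (T 0 3)
      ring

theorem genPair_chain (s n : ℕ) (t : Fin s → Fin n → Fin 4 → B) :
    genPair (fun T => ∏ i, ∏ j, ∏ k, edgeWeight (t i j k) (T i j k)) (chain n s) =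
      chainPair s t := by
  induction s with
  | zero => exact (genPair_point _).trans (by simp [chainPair])
  | succ s ih =>
    rw [chain, genPair_comap (chainEquiv s n) (mulWeight
        (fun T => ∏ j, ∏ k, edgeWeight (t 0 j k) (T j k))
        (fun T => ∏ i, ∏ j, ∏ k, edgeWeight (Fin.tail t i j k) (T i j k))),
      genPair_series, genPair_ray, ih, chainPair]
    intro T
    rw [Fin.prod_univ_succ]
    rfl

end Network

namespace Network

/-! ## Networks and colourings -/

/-- The colourings `f : X` of the vertices of a network with given colour `x` at its right
terminal: which of them are constant along the edges, what is the colour of the left terminal,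
which of them are constant; `joined` and `split` describe these colourings. -/
structure Describes {X : Type*} (joined split : Prop) (compat : X → Bool → Prop)
    (left : X → Bool → Bool) (isConst : X → Bool → Prop) : Prop where
  left_eq : ∀ f x, isConst f x → left f x = x
  exists_const : ∀ x, ∃ f, compat f x ∧ isConst f x
  joined_imp : joined → ∀ f x, compat f x → isConst f x
  split_imp : joined ∨ split → ∀ f x, compat f x → left f x = x → isConst f x
  not_joined : ¬ joined → joined ∨ split → ∀ x, ∃ f, compat f x ∧ left f x = !x
  not_split : ¬ (joined ∨ split) → ∀ x, ∃ f, compat f x ∧ left f x = x ∧ ¬ isConst f x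

/-- The colour of the left terminal of a ray. -/
def rayLeft : (n : ℕ) → (Fin n → Bool → Bool) → Bool → Bool
  | 0, _, x => x
  | _ + 1, f, _ => f 0 false

/-- The colouring `f` of a ray is constant along the edges in `T`. -/
def RayCompat : (n : ℕ) → (Fin n → Fin 4 → Bool) → (Fin n → Bool → Bool) → Bool → Prop
  | 0, _, _, _ => True
  | n + 1, T, f, x => (T 0 0 = true → f 0 false = f 0 true) ∧
      (T 0 1 = true → f 0 false = f 0 true) ∧
      (T 0 2 = true → f 0 false = rayLeft n (Fin.tail f) (f 0 true)) ∧
      (T 0 3 = true → f 0 true = x) ∧ RayCompat n (Fin.tail T) (Fin.tail f) (f 0 true)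

/-- Unfolds the series-parallel construction, merging the cases of the two parallel edges `0` and
`1`, so that the colouring argument becomes a case analysis. -/
theorem ray_succ_joined (n : ℕ) (T : Fin (n + 1) → Fin 4 → Bool) : (ray (n + 1)).joined T ↔
    ((((T 0 2 = true ∧ (ray n).joined (Fin.tail T)) ∨
      ((T 0 0 = true ∨ T 0 1 = true) ∧ ((ray n).joined (Fin.tail T) ∨
        (T 0 2 = true ∧ (ray n).split (Fin.tail T))))) ∧ T 0 3 = true)) := by
  change (((True ∧ ((True ∧ (T 0 2 = true ∧ (ray n).joined (Fin.tail T))) ∨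
    (T 0 1 = true ∧ ((True ∧ (ray n).joined (Fin.tail T)) ∨
      (T 0 2 = true ∧ (ray n).split (Fin.tail T)))))) ∨
        (T 0 0 = true ∧ (True ∧ ((True ∧ (ray n).joined (Fin.tail T)) ∨
      (T 0 2 = true ∧ (ray n).split (Fin.tail T)))))) ∧ T 0 3 = true) ↔ _
  tauto

theorem ray_succ_split (n : ℕ) (T : Fin (n + 1) → Fin 4 → Bool) : (ray (n + 1)).split T ↔
    (((ray n).joined (Fin.tail T) ∨ (T 0 2 = true ∧ (ray n).split (Fin.tail T))) ∧
      T 0 3 = true) ∨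
    ((T 0 2 = true ∧ (ray n).joined (Fin.tail T)) ∨
      ((T 0 0 = true ∨ T 0 1 = true) ∧ ((ray n).joined (Fin.tail T) ∨
        (T 0 2 = true ∧ (ray n).split (Fin.tail T))))) := by
  change ((True ∧ (True ∧ ((True ∧ (ray n).joined (Fin.tail T)) ∨
      (T 0 2 = true ∧ (ray n).split (Fin.tail T))))) ∧ T 0 3 = true) ∨
    (((True ∧ ((True ∧ (T 0 2 = true ∧ (ray n).joined (Fin.tail T))) ∨
    (T 0 1 = true ∧ ((True ∧ (ray n).joined (Fin.tail T)) ∨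
      (T 0 2 = true ∧ (ray n).split (Fin.tail T)))))) ∨
        (T 0 0 = true ∧ (True ∧ ((True ∧ (ray n).joined (Fin.tail T)) ∨
      (T 0 2 = true ∧ (ray n).split (Fin.tail T)))))) ∧ True) ↔ _
  tauto

/-- The right terminal is not a vertex of the ray, so its colour is a parameter `x`. Being connected
after identification of the terminals is `joined ∨ split`, since `point` is joined but by convention
not split (its `Q` is `0`). -/
theorem ray_describes (n : ℕ) (T : Fin n → Fin 4 → Bool) :
    Describes ((ray n).joined T) ((ray n).split T) (RayCompat n T) (rayLeft n)
      (fun f x => ∀ j c, f j c = x) := by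
  induction n with
  | zero =>
    have h : (ray 0).joined T := trivial
    exact ⟨fun _ _ _ => rfl, fun x => ⟨fun j => j.elim0, trivial, fun j => j.elim0⟩,
      fun _ _ _ _ j => j.elim0, fun _ _ _ _ _ j => j.elim0, fun h' => absurd h h',
      fun h' => absurd (Or.inl h) h'⟩
  | succ n ih =>
    obtain ⟨hl, hc, h₁, h₂, h₃, h₄⟩ := ih (Fin.tail T)
    have hJ := ray_succ_joined n T
    have hS := ray_succ_split n T
    -- All witnesses are obtained by colouring the two vertices of the first node `l` and `r` and
    -- extending by a colouring `f` of the other nodes, whose right terminal is the vertex coloured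
    -- `r`.
    have build : ∀ (l r x : Bool) (f : Fin n → Bool → Bool),
        (T 0 0 = true → l = r) → (T 0 1 = true → l = r) → (T 0 2 = true → l = rayLeft n f r) →
        (T 0 3 = true → r = x) → RayCompat n (Fin.tail T) f r →
        RayCompat (n + 1) T (Fin.cons (α := fun _ => Bool → Bool) (fun c => bif c then r else l) f) x :=
      fun l r x f ha hb hc hd hf => ⟨ha, hb, hc, hd, hf⟩
    have unif : ∀ (f : Fin (n + 1) → Bool → Bool) (x : Bool), f 0 false = x → f 0 true = x →
        (∀ j c, Fin.tail f j c = x) → ∀ j c, f j c = x := by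
      intro f x hf0 hf1 hf j
      refine Fin.cases (fun c => ?_) (fun j => hf j) j
      cases c
      · exact hf0
      · exact hf1
    generalize (ray (n + 1)).joined T = J at *
    generalize (ray (n + 1)).split T = S at *
    generalize (ray n).joined (Fin.tail T) = J' at *
    generalize (ray n).split (Fin.tail T) = S' at *
    refine ⟨fun f x hf => hf 0 false, fun x => ?_, ?_, ?_, ?_, ?_⟩
    · obtain ⟨f, hf, hf'⟩ := hc x
      exact ⟨_, build x x x f (fun _ => rfl) (fun _ => rfl) (fun _ => (hl f x hf').symm)
        (fun _ => rfl) hf, unif _ _ rfl rfl hf'⟩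
    · rintro hj f x ⟨ha, hb, hc, hd, hf⟩
      obtain ⟨hj, h3⟩ := hJ.1 hj
      obtain rfl := hd h3
      have hl' := hl (Fin.tail f) (f 0 true)
      have h₁' := fun h => h₁ h (Fin.tail f) (f 0 true) hf
      have h₂' := fun h => h₂ (Or.inr h) (Fin.tail f) (f 0 true) hf
      have key : (∀ j c, Fin.tail f j c = f 0 true) ∧ f 0 false = f 0 true := by
        rcases hj with ⟨h2, hj⟩ | ⟨h01, hj | ⟨h2, hs⟩⟩
        · exact ⟨h₁' hj, (hc h2).trans (hl' (h₁' hj))⟩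
        · exact ⟨h₁' hj, h01.elim ha hb⟩
        · have e := h01.elim ha hb
          exact ⟨h₂' hs ((hc h2).symm.trans e), e⟩
      exact unif _ _ key.2 rfl key.1
    · rintro hs f x ⟨ha, hb, hc, hd, hf⟩ (rfl : f 0 false = x)
      have hl' := hl (Fin.tail f) (f 0 true)
      have h₁' := fun h => h₁ h (Fin.tail f) (f 0 true) hf
      have h₂' := fun h => h₂ (Or.inr h) (Fin.tail f) (f 0 true) hf
      have key : (∀ j c, Fin.tail f j c = f 0 true) ∧ f 0 true = f 0 false := by
        have hs' := hs.elim (fun h => Or.inr (hJ.1 h).1) hS.1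
        rcases hs' with ⟨hj | ⟨h2, hs⟩, h3⟩ | ⟨h2, hj⟩ | ⟨h01, hj | ⟨h2, hs⟩⟩
        · exact ⟨h₁' hj, hd h3⟩
        · exact ⟨h₂' hs ((hc h2).symm.trans (hd h3).symm), hd h3⟩
        · exact ⟨h₁' hj, ((hc h2).trans (hl' (h₁' hj))).symm⟩
        · exact ⟨h₁' hj, (h01.elim ha hb).symm⟩
        · have e := h01.elim ha hb
          exact ⟨h₂' hs ((hc h2).symm.trans e), e.symm⟩
      exact unif _ _ rfl key.2 fun j c => (key.1 j c).trans key.2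
    · intro hj hs x
      have hs' : _ ∨ _ := hs.elim (fun h => absurd h hj) hS.1
      by_cases h3 : T 0 3 = true
      · have hC := fun h => hj (hJ.2 ⟨h, h3⟩)
        have hS1 := hs'.elim And.left fun h => absurd h hC
        have h01 : ¬ (T 0 0 = true ∨ T 0 1 = true) := fun h => hC (Or.inr ⟨h, hS1⟩)
        by_cases h2 : T 0 2 = true
        · obtain ⟨f, hf, hf'⟩ := h₃ (fun h => hC (Or.inl ⟨h2, h⟩)) (hS1.imp id And.right) x
          exact ⟨_, build (!x) x x f (fun h => absurd (Or.inl h) h01)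
            (fun h => absurd (Or.inr h) h01) (fun _ => hf'.symm) (fun _ => rfl) hf, rfl⟩
        · obtain ⟨f, hf, hf'⟩ := hc x
          exact ⟨_, build (!x) x x f (fun h => absurd (Or.inl h) h01)
            (fun h => absurd (Or.inr h) h01) (fun h => absurd h h2) (fun _ => rfl) hf, rfl⟩
      · obtain ⟨f, hf, hf'⟩ := hc (!x)
        exact ⟨_, build (!x) (!x) x f (fun _ => rfl) (fun _ => rfl)
          (fun _ => (hl f _ hf').symm) (fun h => absurd h h3) hf, rfl⟩
    · intro hs x
      rw [hS] at hs
      have hC := fun h => hs (Or.inr (Or.inr h))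
      by_cases hs1 : J' ∨ (T 0 2 = true ∧ S')
      · have h3 : ¬ T 0 3 = true := fun h => hs (Or.inr (Or.inl ⟨hs1, h⟩))
        have h01 : ¬ (T 0 0 = true ∨ T 0 1 = true) := fun h => hC (Or.inr ⟨h, hs1⟩)
        by_cases h2 : T 0 2 = true
        · obtain ⟨f, hf, hf'⟩ := h₃ (fun h => hC (Or.inl ⟨h2, h⟩)) (hs1.imp id And.right) (!x)
          exact ⟨_, build x (!x) x f (fun h => absurd (Or.inl h) h01)
            (fun h => absurd (Or.inr h) h01) (fun _ => by rw [hf', Bool.not_not])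
            (fun h => absurd h h3) hf, rfl, fun h => Bool.not_ne_self x (h 0 true)⟩
        · obtain ⟨f, hf, hf'⟩ := hc (!x)
          exact ⟨_, build x (!x) x f (fun h => absurd (Or.inl h) h01)
            (fun h => absurd (Or.inr h) h01) (fun h => absurd h h2)
            (fun h => absurd h h3) hf, rfl, fun h => Bool.not_ne_self x (h 0 true)⟩
      · by_cases hs2 : J' ∨ S'
        · obtain ⟨f, hf, hf'⟩ := h₃ (fun h => hs1 (Or.inl h)) hs2 x
          exact ⟨_, build x x x f (fun _ => rfl) (fun _ => rfl) 
            (fun h => absurd (hs2.imp id (And.intro h)) hs1)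
            (fun _ => rfl) hf, rfl, fun h => Bool.not_ne_self x
              (hf'.symm.trans (hl f x fun j => h j.succ))⟩
        · obtain ⟨f, hf, hf', hf''⟩ := h₄ hs2 x
          exact ⟨_, build x x x f (fun _ => rfl) (fun _ => rfl) (fun _ => hf'.symm)
            (fun _ => rfl) hf, rfl, fun h => hf'' fun j => h j.succ⟩

/-- The colour of the left terminal of a sequence of rays. -/
def chainLeft {n : ℕ} : (s : ℕ) → (Fin s → Fin n → Bool → Bool) → Bool → Bool
  | 0, _, x => x
  | s + 1, f, x => rayLeft n (f 0) (chainLeft s (Fin.tail f) x)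

/-- The colouring `f` of a sequence of rays is constant along the edges in `T`. -/
def ChainCompat {n : ℕ} :
    (s : ℕ) → (Fin s → Fin n → Fin 4 → Bool) → (Fin s → Fin n → Bool → Bool) → Bool → Prop
  | 0, _, _, _ => True
  | s + 1, T, f, x => RayCompat n (T 0) (f 0) (chainLeft s (Fin.tail f) x) ∧
      ChainCompat s (Fin.tail T) (Fin.tail f) x

theorem or_series_iff {a b c d : Prop} :
    (a ∧ c) ∨ ((b ∧ c) ∨ (a ∧ d)) ↔ ((a ∨ b) ∧ c) ∨ (a ∧ (c ∨ d)) := by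
  tauto

/-- Colourings of the first ray and of the remaining chain are glued at their common terminal, whose
colour is `chainLeft` of the remaining chain. -/
theorem chain_describes (s n : ℕ) (T : Fin s → Fin n → Fin 4 → Bool) :
    Describes ((chain n s).joined T) ((chain n s).split T) (ChainCompat s T) (chainLeft s)
      (fun f x => ∀ i j c, f i j c = x) := by
  induction s with
  | zero =>
    have h : (chain n 0).joined T := trivial
    exact ⟨fun _ _ _ => rfl, fun x => ⟨fun j => j.elim0, trivial, fun j => j.elim0⟩,
      fun _ _ _ _ j => j.elim0, fun _ _ _ _ _ j => j.elim0, fun h' => absurd h h',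
      fun h' => absurd (Or.inl h) h'⟩
  | succ s ih =>
    obtain ⟨hl, hc, h₁, h₂, h₃, h₄⟩ := ih (Fin.tail T)
    obtain ⟨kl, kc, k₁, k₂, k₃, k₄⟩ := ray_describes n (T 0)
    have hJ : (chain n (s + 1)).joined T ↔ (ray n).joined (T 0) ∧ (chain n s).joined (Fin.tail T) :=
      Iff.rfl
    have hS : (chain n (s + 1)).joined T ∨ (chain n (s + 1)).split T ↔
      (((ray n).joined (T 0) ∨ (ray n).split (T 0)) ∧ (chain n s).joined (Fin.tail T)) ∨
        ((ray n).joined (T 0) ∧ ((chain n s).joined (Fin.tail T) ∨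
          (chain n s).split (Fin.tail T))) := or_series_iff
    have unif : ∀ (f : Fin (s + 1) → Fin n → Bool → Bool) (x : Bool), (∀ j c, f 0 j c = x) →
        (∀ i j c, Fin.tail f i j c = x) → ∀ i j c, f i j c = x :=
      fun f x hf0 hf i => Fin.cases hf0 hf i
    have build : ∀ (x : Bool) (f : Fin n → Bool → Bool) (g : Fin s → Fin n → Bool → Bool),
        RayCompat n (T 0) f (chainLeft s g x) → ChainCompat s (Fin.tail T) g x →
        ChainCompat (s + 1) T (Fin.cons (α := fun _ => Fin n → Bool → Bool) f g) x :=
      fun x f g hf hg => ⟨hf, hg⟩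
    generalize (chain n (s + 1)).joined T = J at *
    generalize (chain n (s + 1)).split T = S at *
    generalize (chain n s).joined (Fin.tail T) = J₂ at *
    generalize (chain n s).split (Fin.tail T) = S₂ at *
    generalize (ray n).joined (T 0) = J₁ at *
    generalize (ray n).split (T 0) = S₁ at *
    refine ⟨fun f x hf => ?_, fun x => ?_, ?_, ?_, ?_, ?_⟩
    · have := hl (Fin.tail f) x fun i => hf i.succ
      change rayLeft n (f 0) (chainLeft s (Fin.tail f) x) = x
      rw [this]
      exact kl _ _ (hf 0)
    · obtain ⟨g, hg, hg'⟩ := hc x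
      obtain ⟨f, hf, hf'⟩ := kc x
      exact ⟨_, build x f g (by rwa [hl g x hg']) hg, unif _ _ hf' hg'⟩
    · rintro hj f x ⟨hf, hg⟩
      have hu := h₁ (hJ.1 hj).2 _ _ hg
      rw [hl _ _ hu] at hf
      exact unif _ _ (k₁ (hJ.1 hj).1 _ _ hf) hu
    · rintro hs f x ⟨hf, hg⟩ hleft
      change rayLeft n (f 0) (chainLeft s (Fin.tail f) x) = x at hleft
      rcases hS.1 hs with ⟨hs, hj⟩ | ⟨hj, hs⟩
      · have hu := h₁ hj _ _ hg
        rw [hl _ _ hu] at hf hleft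
        exact unif _ _ (k₂ hs _ _ hf hleft) hu
      · have hu := k₁ hj _ _ hf
        have hm : chainLeft s (Fin.tail f) x = x := (kl _ _ hu).symm.trans hleft
        rw [hm] at hu
        exact unif _ _ hu (h₂ hs _ _ hg hm)
    · intro hj hs x
      by_cases hj₂ : J₂
      · obtain ⟨g, hg, hg'⟩ := hc x
        obtain ⟨f, hf, hf'⟩ := k₃ (fun h => hj (hJ.2 ⟨h, hj₂⟩))
          ((hS.1 hs).elim And.left fun h => Or.inl h.1) x
        have hm := hl g x hg'
        refine ⟨_, build x f g (by rwa [hm]) hg, ?_⟩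
        change rayLeft n f (chainLeft s g x) = _
        rw [hm, hf']
      · obtain ⟨g, hg, hg'⟩ := h₃ hj₂ ((hS.1 hs).elim (fun h => absurd h.2 hj₂) And.right) x
        obtain ⟨f, hf, hf'⟩ := kc (!x)
        refine ⟨_, build x f g (by rwa [hg']) hg, ?_⟩
        change rayLeft n f (chainLeft s g x) = _
        rw [hg', kl _ _ hf']
    · intro hs x
      by_cases hs₂ : J₂ ∨ S₂
      · by_cases hs₁ : J₁ ∨ S₁
        · obtain ⟨g, hg, hg'⟩ := h₃ (fun h => hs (hS.2 (Or.inl ⟨hs₁, h⟩))) hs₂ x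
          obtain ⟨f, hf, hf'⟩ := k₃ (fun h => hs (hS.2 (Or.inr ⟨h, hs₂⟩))) hs₁ (!x)
          refine ⟨_, build x f g (by rwa [hg']) hg, ?_, fun h => ?_⟩
          · change rayLeft n f (chainLeft s g x) = _
            rw [hg', hf', Bool.not_not]
          · exact Bool.not_ne_self x (hg'.symm.trans (hl g x fun i => h i.succ))
        · obtain ⟨g, hg, hg'⟩ := hc x
          obtain ⟨f, hf, hf', hf''⟩ := k₄ hs₁ x
          have hm := hl g x hg'
          refine ⟨_, build x f g (by rwa [hm]) hg, ?_, fun h => hf'' (h 0)⟩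
          change rayLeft n f (chainLeft s g x) = _
          rw [hm, hf']
      · obtain ⟨g, hg, hg', hg''⟩ := h₄ hs₂ x
        obtain ⟨f, hf, hf'⟩ := kc x
        refine ⟨_, build x f g (by rwa [hg']) hg, ?_, fun h => hg'' fun i => h i.succ⟩
        change rayLeft n f (chainLeft s g x) = _
        rw [hg', kl _ _ hf']

/-- For nonempty chains of nonempty rays, `joined ∨ split` therefore reduces to `split`: the first
ray becomes split by forgetting its edge `3`. -/
theorem split_of_joined (s n : ℕ) (T : Fin (s + 1) → Fin (n + 1) → Fin 4 → Bool)
    (h : (chain (n + 1) (s + 1)).joined T) : (chain (n + 1) (s + 1)).split T :=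
  Or.inl ⟨(ray_succ_split n (T 0)).2 (Or.inr ((ray_succ_joined n (T 0)).1 h.1).1), h.2⟩

end Network

/-! ### The melonic star as a closed chain of rays -/

namespace Network

theorem rayCompat_iff (n : ℕ) (T : Fin n → Fin 4 → Bool) (f : Fin n → Bool → Bool) (x : Bool) :
    RayCompat n T f x ↔ ∀ j : Fin n, (T j 0 = true → f j false = f j true) ∧
      (T j 1 = true → f j false = f j true) ∧
      (T j 2 = true → f j false =
        if h : j.val + 1 < n then f ⟨j.val + 1, h⟩ false else f j true) ∧
      (T j 3 = true → f j true = if j.val = 0 then x else f ⟨j.val - 1, by omega⟩ true) := by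
  induction n generalizing x with
  | zero => exact ⟨fun _ j => j.elim0, fun _ => trivial⟩
  | succ n ih =>
    rw [Fin.forall_fin_succ, RayCompat, ih]
    have h₁ : rayLeft n (Fin.tail f) (f 0 true) = if h : (0 : Fin (n + 1)).val + 1 < n + 1 then
        f ⟨(0 : Fin (n + 1)).val + 1, h⟩ false else f 0 true := by
      cases n with
      | zero => simp [rayLeft]
      | succ n => simp [rayLeft, Fin.tail]
    rw [h₁]
    simp only [Fin.val_zero, if_true]
    have h₂ : ∀ j : Fin n, (if h : j.val + 1 < n then Fin.tail f ⟨j.val + 1, h⟩ false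
        else Fin.tail f j true) = if h : j.succ.val + 1 < n + 1 then
          f ⟨j.succ.val + 1, h⟩ false else f j.succ true := by
      intro j
      by_cases h : j.val + 1 < n
      · rw [dif_pos h, dif_pos (by simpa using h)]
        rfl
      · rw [dif_neg h, dif_neg (by simpa using h)]
        rfl
    have h₃ : ∀ j : Fin n, (if j.val = 0 then f 0 true
        else Fin.tail f ⟨j.val - 1, by omega⟩ true) = if j.succ.val = 0 then x else
          f ⟨j.succ.val - 1, by omega⟩ true := by
      intro j
      rw [if_neg (by simp : ¬ j.succ.val = 0)]
      by_cases h : j.val = 0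
      · rw [if_pos h]
        congr 1
        exact Fin.ext (by simp [h])
      · rw [if_neg h, Fin.tail]
        congr 1
        refine Fin.ext ?_
        simp
        omega
    simp only [h₂, h₃]
    simp only [and_assoc]
    rfl

theorem chainCompat_iff (s n : ℕ) (T : Fin s → Fin (n + 1) → Fin 4 → Bool)
    (f : Fin s → Fin (n + 1) → Bool → Bool) (x : Bool) :
    ChainCompat s T f x ↔ ∀ i : Fin s, RayCompat (n + 1) (T i) (f i)
      (if h : i.val + 1 < s then f ⟨i.val + 1, h⟩ 0 false else x) := by
  induction s with
  | zero => exact ⟨fun _ j => j.elim0, fun _ => trivial⟩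
  | succ s ih =>
    rw [Fin.forall_fin_succ, ChainCompat, ih]
    have h₁ : chainLeft s (Fin.tail f) x = if h : (0 : Fin (s + 1)).val + 1 < s + 1 then
        f ⟨(0 : Fin (s + 1)).val + 1, h⟩ 0 false else x := by
      cases s with
      | zero => simp [chainLeft]
      | succ s => simp [chainLeft, rayLeft, Fin.tail]
    have h₂ : ∀ i : Fin s, (if h : i.val + 1 < s then Fin.tail f ⟨i.val + 1, h⟩ 0 false
        else x) = if h : i.succ.val + 1 < s + 1 then
          f ⟨i.succ.val + 1, h⟩ 0 false else x := by
      intro i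
      by_cases h : i.val + 1 < s
      · rw [dif_pos h, dif_pos (by simpa using h)]
        rfl
      · rw [dif_neg h, dif_neg (by simpa using h)]
    rw [h₁]
    simp only [h₂]
    rfl

theorem forall_sym2_eq_iff {V : Type} (f : V → Bool) (a b : V) :
    (∀ u v, s(a, b) = s(u, v) → f u = f v) ↔ f a = f b := by
  refine ⟨fun h => h a b rfl, fun h u v huv => ?_⟩
  rcases Sym2.eq_iff.1 huv with ⟨rfl, rfl⟩ | ⟨rfl, rfl⟩
  · exact h
  · exact h.symm

/-- The right terminal of the chain gets the colour of `(0, 0, false)`, its left terminal: this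
closes the central oval. -/
theorem starGraph_compat_iff (s n : ℕ) (T : Finset (Fin (s + 1) × Fin (n + 1) × Fin 4))
    (f : Fin (s + 1) × Fin (n + 1) × Bool → Bool) :
    (∀ e ∈ T, ∀ u v, (starGraph (s + 1) (n + 1)).ends e = s(u, v) → f u = f v) ↔
      ChainCompat (s + 1) (fun i j k => decide ((i, j, k) ∈ T)) (fun i j c => f (i, j, c))
        (f (0, 0, false)) := by
  rw [chainCompat_iff]
  simp only [rayCompat_iff, Prod.forall, decide_eq_true_eq]
  refine forall_congr' fun i => forall_congr' fun j => ?_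
  have h : ∀ p : Fin 4 → Prop, (∀ k, p k) ↔ p 0 ∧ p 1 ∧ p 2 ∧ p 3 := fun p => by
    simp [Fin.forall_fin_succ]
  rw [h]
  refine and_congr (imp_congr_right fun _ => ?_) (and_congr (imp_congr_right fun _ => ?_)
    (and_congr (imp_congr_right fun _ => ?_) (imp_congr_right fun _ => ?_)))
  · have e : (starGraph (s + 1) (n + 1)).ends (i, j, 0) = s((i, j, false), (i, j, true)) := rfl
    rw [e]
    simpa only [Prod.forall] using forall_sym2_eq_iff f (i, j, false) (i, j, true)
  · have e : (starGraph (s + 1) (n + 1)).ends (i, j, 1) = s((i, j, false), (i, j, true)) := rfl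
    rw [e]
    simpa only [Prod.forall] using forall_sym2_eq_iff f (i, j, false) (i, j, true)
  · have e : (starGraph (s + 1) (n + 1)).ends (i, j, 2) = if h : j.val + 1 < n + 1 then
        s((i, j, false), (i, ⟨j.val + 1, h⟩, false)) else s((i, j, false), (i, j, true)) := rfl
    rw [e]
    split_ifs with h
    · simpa only [Prod.forall] using forall_sym2_eq_iff f (i, j, false) (i, ⟨j.val + 1, h⟩, false)
    · simpa only [Prod.forall] using forall_sym2_eq_iff f (i, j, false) (i, j, true)
  · have e : (starGraph (s + 1) (n + 1)).ends (i, j, 3) = if j.val = 0 then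
        s((i, j, true), (finRotate (s + 1) i, j, false)) else
          s((i, ⟨j.val - 1, by omega⟩, true), (i, j, true)) := rfl
    rw [e]
    by_cases hj : j.val = 0
    · obtain rfl : j = 0 := Fin.ext hj
      simp only [Fin.val_zero, if_true]
      have h' : (if h : i.val + 1 < s + 1 then f (⟨i.val + 1, h⟩, 0, false) else f (0, 0, false)) =
          f (finRotate (s + 1) i, 0, false) := by
        split_ifs with h
        · have : finRotate (s + 1) i = ⟨i.val + 1, h⟩ := finRotate_of_lt (by omega)
          rw [this]
        -- The last ray is followed cyclically by the first one.
        · obtain rfl : i = Fin.last s := Fin.ext (by simp; omega)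
          rw [finRotate_last]
      rw [h']
      simpa only [Prod.forall] using
        forall_sym2_eq_iff f (i, 0, true) (finRotate (s + 1) i, 0, false)
    · rw [if_neg hj, if_neg hj]
      refine Iff.trans ?_ eq_comm
      simpa only [Prod.forall] using
        forall_sym2_eq_iff f (i, ⟨j.val - 1, by omega⟩, true) (i, j, true)

/-- Colourings of the star are colourings of the chain with equal colours at both terminals, and
these are the ones governed by `split_imp` and `not_split`. -/
theorem starGraph_connects_iff (s n : ℕ) (T : Finset (Fin (s + 1) × Fin (n + 1) × Fin 4)) :
    (starGraph (s + 1) (n + 1)).Connects T ↔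
      (chain (n + 1) (s + 1)).split fun i j k => decide ((i, j, k) ∈ T) := by
  have hd := chain_describes (s + 1) (n + 1) fun i j k => decide ((i, j, k) ∈ T)
  have hs := split_of_joined s n fun i j k => decide ((i, j, k) ∈ T)
  constructor
  · intro h
    by_contra hcon
    obtain ⟨f, hf, hleft, hconst⟩ := hd.not_split (fun h => h.elim (fun h => hcon (hs h)) hcon) false
    have hleft : f 0 0 false = false := hleft
    have := h (fun v => f v.1 v.2.1 v.2.2) ((starGraph_compat_iff s n T _).2 (by
      change ChainCompat (s + 1) _ f (f 0 0 false)
      rwa [hleft]))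
    exact hconst fun i j c => (this (i, j, c) (0, 0, false)).trans hleft
  · intro h f hf u v
    have := hd.split_imp (Or.inr h) _ _ ((starGraph_compat_iff s n T f).1 hf) rfl
    exact (this u.1 u.2.1 u.2.2).trans (this v.1 v.2.1 v.2.2).symm

/-- Sets of edges as functions. -/
def edgeSetEquiv (s n : ℕ) :
    Finset (Fin s × Fin n × Fin 4) ≃o (Fin s → Fin n → Fin 4 → Bool) where
  toFun T i j k := decide ((i, j, k) ∈ T)
  invFun T := Finset.univ.filter fun e => T e.1 e.2.1 e.2.2 = true
  left_inv T := by
    ext e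
    simp
  right_inv T := by
    funext i j k
    simp
  map_rel_iff' := by
    intro S T
    simp only [Equiv.coe_fn_mk, Pi.le_def, Bool.le_iff_imp, decide_eq_true_eq]
    exact ⟨fun h e he => h e.1 e.2.1 e.2.2 he, fun h i j k he => h he⟩

/-- Spanning trees correspond to minimal split sets, and `edgeWeight` contributes exactly the
variables of the edges outside the tree. -/
theorem aeval_kirchhoffSymanzik {K : Type u} [Field K] {B : Type u} [CommRing B] [Algebra K B]
    (s n : ℕ) (t : Fin (s + 1) × Fin (n + 1) × Fin 4 → B) :
    MvPolynomial.aeval t ((starGraph (s + 1) (n + 1)).kirchhoffSymanzik K) =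
      (chainPair (s + 1) fun i j k => t (i, j, k)).2 := by
  classical
  have hmin : ∀ T, (starGraph (s + 1) (n + 1)).IsSpanningTree T ↔
      Minimal (chain (n + 1) (s + 1)).split (edgeSetEquiv (s + 1) (n + 1) T) := by
    intro T
    rw [Multigraph.isSpanningTree_iff_minimal, ← minimal_comp_iff]
    have : (starGraph (s + 1) (n + 1)).Connects = fun T =>
      (chain (n + 1) (s + 1)).split (edgeSetEquiv (s + 1) (n + 1) T) :=
        funext fun T => propext (starGraph_connects_iff s n T)
    rw [this]
  rw [← genPair_chain, genPair, gen, Multigraph.kirchhoffSymanzik, map_sum, Finset.sum_filter]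
  refine Fintype.sum_equiv (edgeSetEquiv (s + 1) (n + 1)).toEquiv _ _ fun T => ?_
  refine if_congr (hmin T) ?_ rfl
  rw [map_prod]
  simp only [MvPolynomial.aeval_X]
  trans ∏ e, edgeWeight (t e) (decide (e ∈ T))
  · rw [← Finset.prod_subset (Finset.subset_univ Tᶜ)]
    · refine Finset.prod_congr (by ext; simp) fun e he => ?_
      simp [edgeWeight, Finset.mem_compl.1 he]
    · intro e _ he
      simp [edgeWeight, not_not.1 (mt Finset.mem_compl.2 he)]
  · simp only [Fintype.prod_prod_type]
    rfl

end Network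

/-! ### The class of the star -/

open PointFunctor

theorem Multigraph.hasClass_grothendieckClass {V E : Type} [Fintype E] (K : Type u) [Field K]
    (G : Multigraph V E) :
    ((line K).pow E).HasClass
      (fun B _ _ t => IsUnit (MvPolynomial.aeval (R := K) (S₁ := B) t (G.kirchhoffSymanzik K)))
      (G.grothendieckClass K) := by
  have hnat : NatFun (F := (line K).pow E)
      (fun B _ _ t => MvPolynomial.aeval (R := K) (S₁ := B) t (G.kirchhoffSymanzik K)) :=
    fun B C _ _ _ _ φ t => by
      rw [← AlgHom.comp_apply, MvPolynomial.comp_aeval]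
  have h := (represents_pow_line E).isUnit _ hnat
  have h' : MvPolynomial.aeval (R := K) (MvPolynomial.X (σ := E) (R := K))
      (G.kirchhoffSymanzik K) = G.kirchhoffSymanzik K := MvPolynomial.aeval_X_left_apply _
  rw [h'] at h
  exact HasClass.congr ⟨_, _, _, inferInstance, _,
    (KVariety.cls_hypersurfaceComplement _).symm, h⟩ fun B _ _ x => by simp

/-- The second component carries an extra factor `𝕃` because its own exponent would be `2 * n - 1`,
which is negative at `n = 0`. -/
theorem rayClass_eq (K : Type u) [Field K] (n : ℕ) :
    (rayClass K n).1 = torusClass K ^ n * lefschetz K ^ (2 * n) *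
        Polynomial.aeval (torusClass K) (rayPoly n).1 ∧
      lefschetz K * (rayClass K n).2 = torusClass K ^ n * lefschetz K ^ (2 * n) *
        Polynomial.aeval (torusClass K) (rayPoly n).2 := by
  induction n with
  | zero => simp [rayClass, rayPoly]
  | succ n ih =>
    obtain ⟨h₁, h₂⟩ := ih
    have hL := lefschetz_eq_add K
    constructor
    · simp only [rayClass, rayPoly, map_add, map_mul, Polynomial.aeval_X, map_one, ← hL]
      linear_combination torusClass K * lefschetz K ^ 3 * h₁ +
        torusClass K * lefschetz K ^ 2 * h₂
    · simp only [rayClass, rayPoly, map_add, map_mul, map_sub, Polynomial.aeval_X, map_one]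
      linear_combination torusClass K * lefschetz K ^ 2 * (torusClass K - 1) * h₁ +
        torusClass K * lefschetz K ^ 2 * h₂

theorem mainTheorem7 (K : Type u) [Field K] (s n : ℕ) (hs : 1 ≤ s) (hn : 1 ≤ n) :
    (starGraph s n).grothendieckClass K =
      torusClass K ^ (s * n) * (torusClass K + 1) ^ (2 * s * n - 1) *
        (Polynomial.aeval (torusClass K) (polyA n)) ^ (s - 1) *
        Polynomial.aeval (torusClass K) (polySigma s n) := by
  obtain ⟨s, rfl⟩ : ∃ k, s = k + 1 := ⟨s - 1, by omega⟩
  obtain ⟨n, rfl⟩ : ∃ k, n = k + 1 := ⟨n - 1, by omega⟩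
  have h := ((starGraph (s + 1) (n + 1)).hasClass_grothendieckClass K).of_bijOn
    (G := (((line K).pow (Fin 4)).pow (Fin (n + 1))).pow (Fin (s + 1)))
    (Ψ := fun B _ _ x => IsUnit (chainPair (B := B) (s + 1) x).2)
    (fun B _ _ t i j k => t (i, j, k)) (fun B C _ _ _ _ φ t => rfl)
    (fun B _ _ t ht => by rwa [Network.aeval_kirchhoffSymanzik] at ht)
    (fun B _ _ t ht => ⟨fun e => t e.1 e.2.1 e.2.2,
      ⟨by rwa [Network.aeval_kirchhoffSymanzik], rfl⟩, by rintro t' ⟨-, rfl⟩; rfl⟩)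
  rw [h.unique (hasClass_closed_chain K s n), polyA_eq, polySigma_eq]
  have hL := lefschetz_eq_add K
  obtain ⟨h₁, h₂⟩ := rayClass_eq K n
  obtain ⟨h₃, -⟩ := rayClass_eq K (n + 1)
  have h₄ : torusClass K * lefschetz K ^ 2 * ((rayClass K n).1 + (rayClass K n).2) =
      torusClass K ^ (n + 1) * lefschetz K ^ (2 * n + 1) *
        Polynomial.aeval (torusClass K) (rayPoly (n + 1)).1 := by
    simp only [rayPoly, map_add, map_mul, Polynomial.aeval_X, map_one, ← hL]
    linear_combination torusClass K * lefschetz K ^ 2 * h₁ +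
        torusClass K * lefschetz K * h₂
  -- Derived from the recursion at level `n`, since `𝕃` cannot be cancelled from `rayClass_eq` at
  -- level `n + 1`.
  have h₅ : (rayClass K (n + 1)).2 = torusClass K ^ (n + 1) * lefschetz K ^ (2 * n + 1) *
        Polynomial.aeval (torusClass K) (rayPoly (n + 1)).2 := by
    simp only [rayClass, rayPoly, map_add, map_mul, map_sub, Polynomial.aeval_X, map_one]
    linear_combination torusClass K * lefschetz K * (torusClass K - 1) * h₁ +
        torusClass K * lefschetz K * h₂
  have h₆ : lefschetz K * (torusClass K * ((torusClass K - 1) * (rayClass K n).1 +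
      lefschetz K * (rayClass K n).2)) = (rayClass K (n + 1)).2 := rfl
  have h₇ : lefschetz K * (torusClass K * lefschetz K ^ 2 *
      ((rayClass K n).1 + (rayClass K n).2)) = (rayClass K (n + 1)).1 := rfl
  set P := (rayClass K (n + 1)).1
  set M := (rayClass K (n + 1)).2
  set M₀ := torusClass K * ((torusClass K - 1) * (rayClass K n).1 +
    lefschetz K * (rayClass K n).2)
  set P₀ := torusClass K * lefschetz K ^ 2 * ((rayClass K n).1 + (rayClass K n).2)
  -- The factor `𝕃 P₀ = P` restores the missing ray; for `s = 0`, where `s - 1` is truncated, both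
  -- sides vanish.
  have h₈ : lefschetz K * (P₀ * (s * M * P ^ (s - 1))) = s * M * P ^ s := by
    cases s with
    | zero => simp
    | succ s =>
      rw [Nat.add_sub_cancel, pow_succ, ← h₇]
      ring
  have e : 2 * (s + 1) * (n + 1) - 1 = 2 * (n + 1) * s + (2 * n + 1) := by
    rw [Nat.sub_eq_iff_eq_add (Nat.mul_pos (by omega) (by omega))]
    ring
  trans P ^ s * (torusClass K * P₀ + (s + 1) * M)
  · linear_combination h₈ + P ^ s * h₆
  · rw [h₃, h₄, h₅, e, ← hL, Nat.add_sub_cancel]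
    simp only [map_add, map_mul, Polynomial.aeval_X, map_natCast, Nat.cast_add, Nat.cast_one,
      map_one]
    ring

end
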